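/- \textbf{Setting.} Let $\Omega\subset\mathbb R^2$ be a polygonal domain, and let $\mathcal T_h$ and $\mathcal T_H$ be conforming, shape-regular and quasi-uniform triangulations of $\overline\Omega$ into closed triangles, with mesh sizes $h=\max_\tau \operatorname{diam}\tau$ and $H=\max_K\operatorname{diam}K$, such that every $\tau\in\mathcal T_h$ is contained in some $K\in\mathcal T_H$. Let $\alpha>0$ be piecewise constant on $\mathcal T_h$, with value $\alpha_\tau$ on $\tau$. For $K\in\mathcal T_H$ put $H_K=\operatorname{diam}K$, let $S^h(K)$ be the space of continuous functions on $K$ that are affine on each $\tau\subset K$, let $S^h_0(K)$ be the subspace of functions that vanish on $\partial K$, and put $|u|_{1,\alpha,K}^2=\int_K\alpha|\nabla u|^2\,dx$. \textbf{Basis functions.} For a vertex $p$ of $K$ the oscillatory boundary data $\psi_{p,\partial K}$ vanish on the edge of $K$ opposite to $p$, and on an edge $\Upsilon=[q,p]$ of $K$ they are $$\psi_{p,\partial K}(x)=\Big(\int_{[q,p]}\alpha^{-1}\,ds\Big)^{-1}\int_{[q,x]}\alpha^{-1}\,ds ,$$ where $\alpha$ on $\partial K$ is taken from inside $K$. The multiscale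 basis function $\phi_{p,K}\in S^h(K)$ is given by $\phi_{p,K}=\psi_{p,\partial K}$ on $\partial K$ and $\int_K\alpha\nabla\phi_{p,K}\cdot\nabla v\,dx=0$ for all $v\in S^h_0(K)$. The coarse robustness indicator is $$\gamma(\alpha)=\max_{K\in\mathcal T_H}\ \max_{p\text{ vertex of }K}|\phi_{p,K}|_{1,\alpha,K}^2 .$$ \textbf{Assumption.} Let $\rho\ge1$. For $K\in\mathcal T_H$ let $K(\rho)=\bigcup\{\tau\subset K:\alpha_\tau>\rho\}$; let $K^B(\rho)$ be the union of the connected components $K^B_l(\rho)$ of $K(\rho)$ that meet $\partial K$, and $K^I(\rho)$ the union of the other components. There are constants $c_0>0$ and $c_1$ such that, for every $K\in\mathcal T_H$: \begin{enumerate} \item $\operatorname{dist}(K^I(\rho),K^B(\rho))\ge h$; \item $\alpha$ takes a single value on the elements of each component $K^B_l(\rho)$; \item each contact set $\Gamma^B_l(\rho)=K^B_l(\rho)\cap\partial K$ is connected, and $|E\setminus\Gamma^B(\rho)|\ge c_0H_K$ for every edge $E$ of $K$, where $\Gamma^B(\rho)=\bigcup_l\Gamma^B_l(\rho)$; \item the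 perimeter of $K^B(\rho)$, i.e.\ the length of its boundary, is at most $c_1H_K$. \end{enumerate} \textbf{Theorem.} Under this assumption all multiscale basis functions $\phi_{p,K}$ exist, the maximum $\gamma(\alpha)$ is attained, and $$\gamma(\alpha)\le C\,\rho\,\frac Hh ,$$ where $C$ depends only on $c_0$, $c_1$ and the shape-regularity and quasi-uniformity constants of the two meshes (in particular not on $\alpha$, $\rho$, $h$, $H$ or $\Omega$). -/

import Mathlib

open MeasureTheory Set

open scoped MeasureTheory

noncomputable section

namespace MSFEM

/-- The Euclidean plane. -/
abbrev Plane : Type := EuclideanSpace ℝ (Fin 2)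

/-- A (conforming) mesh is a geometric simplicial complex in the plane. -/
abbrev Mesh : Type := Geometry.SimplicialComplex ℝ Plane

/-- The closed triangle (or edge) spanned by a finite set of vertices. -/
abbrev hull (s : Finset Plane) : Set Plane := convexHull ℝ (s : Set Plane)

/-- The elements of a mesh are its triangles, each given by its three vertices. -/
def elements (T : Mesh) : Set (Finset Plane) := {s | s ∈ T.faces ∧ s.card = 3}

/-- `T` is a triangulation of the closed region `D`: it is finite, every vertex and every edge
belongs to a triangle, and the triangles cover exactly `D`. -/
structure IsTriangulation (T : Mesh) (D : Set Plane) : Prop where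
  finite : T.faces.Finite
  pure : ∀ s ∈ T.faces, ∃ t ∈ elements T, s ⊆ t
  space_eq : T.space = D

/-- The mesh size: the largest diameter of an element. -/
def meshSize (T : Mesh) : ℝ := sSup ((fun s => Metric.diam (hull s)) '' elements T)

/-- Shape regularity with constant `σ`: every element contains a disc whose radius is at least
the diameter of the element divided by `σ`. -/
def ShapeRegular (T : Mesh) (σ : ℝ) : Prop :=
  ∀ s ∈ elements T, ∃ x, Metric.closedBall x (Metric.diam (hull s) / σ) ⊆ hull s

/-- Quasi-uniformity with constant `σ`: all elements have diameter comparable to the mesh size. -/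
def QuasiUniform (T : Mesh) (σ : ℝ) : Prop :=
  ShapeRegular T σ ∧ ∀ s ∈ elements T, meshSize T ≤ σ * Metric.diam (hull s)

/-- The coarse mesh is aligned with the fine mesh: no fine element crosses a coarse edge. -/
def Aligned (Tf Tc : Mesh) : Prop := ∀ τ ∈ elements Tf, ∃ K ∈ elements Tc, hull τ ⊆ hull K

/-- The fine elements contained in the coarse element `K`. -/
def fineElements (Tf : Mesh) (K : Finset Plane) : Set (Finset Plane) :=
  {τ | τ ∈ elements Tf ∧ hull τ ⊆ hull K}

/-! The coefficient is piecewise constant on the fine mesh, and is given by its value `α τ` on each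
fine element `τ`. -/

/-- `∫_K α ∇u · ∇v dx`, for functions that are smooth inside each fine element. -/
def energyForm (Tf : Mesh) (α : Finset Plane → ℝ) (K : Finset Plane) (u v : Plane → ℝ) : ℝ :=
  ∑ᶠ τ ∈ fineElements Tf K,
    α τ * ∫ x in interior (hull τ), inner ℝ (gradient u x) (gradient v x)

/-- The conforming `P₁` space `S^h(K)`: continuous on `K` and affine on each fine element. -/
def IsP1 (Tf : Mesh) (K : Finset Plane) (u : Plane → ℝ) : Prop :=
  ContinuousOn u (hull K) ∧
    ∀ τ ∈ fineElements Tf K, ∃ g : Plane →ᵃ[ℝ] ℝ, EqOn u g (hull τ)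

/-- The subspace `S^h_0(K)` of functions that vanish on the boundary of `K`. -/
def IsP1Zero (Tf : Mesh) (K : Finset Plane) (u : Plane → ℝ) : Prop :=
  IsP1 Tf K u ∧ ∀ x ∈ frontier (hull K), u x = 0

/-- The line integral of `1 / α` over a subset `A` of an edge of the coarse element `K`, with the
values of `α` taken from inside `K`. -/
def resistance (Tf : Mesh) (α : Finset Plane → ℝ) (K : Finset Plane) (A : Set Plane) : ℝ :=
  ∑ᶠ τ ∈ fineElements Tf K, (α τ)⁻¹ * (μH[1] (A ∩ hull τ)).toReal

/-- On the boundary of `K`, the function `u` equals the oscillatory boundary data of the vertex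
`p`: on an edge from another vertex `q` to `p` it is `∫_{[q,x]} α⁻¹ ds / ∫_{[q,p]} α⁻¹ ds`, and on
the edge opposite to `p` it is `0`. -/
def HasOscillatoryData (Tf : Mesh) (α : Finset Plane → ℝ) (K : Finset Plane) (p : Plane)
    (u : Plane → ℝ) : Prop :=
  (∀ q ∈ K, q ≠ p → ∀ x ∈ segment ℝ q p,
    u x = resistance Tf α K (segment ℝ q x) / resistance Tf α K (segment ℝ q p)) ∧
  ∀ q ∈ K, q ≠ p → ∀ r ∈ K, r ≠ p → ∀ x ∈ segment ℝ q r, u x = 0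

/-- `φ` is the multiscale basis function of the coarse element `K` and its vertex `p`: the discrete
`α`-harmonic extension into `K` of the oscillatory boundary data. -/
structure IsMultiscaleBasis (Tf : Mesh) (α : Finset Plane → ℝ) (K : Finset Plane) (p : Plane)
    (φ : Plane → ℝ) : Prop where
  isP1 : IsP1 Tf K φ
  boundary : HasOscillatoryData Tf α K p φ
  harmonic : ∀ v, IsP1Zero Tf K v → energyForm Tf α K φ v = 0

/-- The energies `|φ_{p,K}|²_{1,α,K}` of all multiscale basis functions. -/
def basisEnergies (Tf Tc : Mesh) (α : Finset Plane → ℝ) : Set ℝ :=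
  {E | ∃ K ∈ elements Tc, ∃ p ∈ K, ∃ φ, IsMultiscaleBasis Tf α K p φ ∧ E = energyForm Tf α K φ φ}

/-- The coarse robustness indicator `γ(α)`. -/
def coarseIndicator (Tf Tc : Mesh) (α : Finset Plane → ℝ) : ℝ := sSup (basisEnergies Tf Tc α)

/-- The high-conductivity region `K(ρ)`: the union of the closed fine elements in `K` on which the
coefficient exceeds `ρ`. -/
def highRegion (Tf : Mesh) (α : Finset Plane → ℝ) (K : Finset Plane) (ρ : ℝ) : Set Plane :=
  ⋃ τ ∈ {τ | τ ∈ fineElements Tf K ∧ ρ < α τ}, hull τ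

/-- The connected components of `K(ρ)` that touch the boundary of `K`. -/
def boundaryComponents (Tf : Mesh) (α : Finset Plane → ℝ) (K : Finset Plane) (ρ : ℝ) :
    Set (Set Plane) :=
  {C | (∃ x ∈ highRegion Tf α K ρ, C = connectedComponentIn (highRegion Tf α K ρ) x) ∧
    (C ∩ frontier (hull K)).Nonempty}

/-- The connected components of `K(ρ)` that do not touch the boundary of `K`. -/
def interiorComponents (Tf : Mesh) (α : Finset Plane → ℝ) (K : Finset Plane) (ρ : ℝ) :
    Set (Set Plane) :=
  {C | (∃ x ∈ highRegion Tf α K ρ, C = connectedComponentIn (highRegion Tf α K ρ) x) ∧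
    ¬ (C ∩ frontier (hull K)).Nonempty}

/-- `K^B(ρ)`. -/
def boundaryPart (Tf : Mesh) (α : Finset Plane → ℝ) (K : Finset Plane) (ρ : ℝ) : Set Plane :=
  ⋃₀ boundaryComponents Tf α K ρ

/-- `K^I(ρ)`. -/
def interiorPart (Tf : Mesh) (α : Finset Plane → ℝ) (K : Finset Plane) (ρ : ℝ) : Set Plane :=
  ⋃₀ interiorComponents Tf α K ρ

/-- The assumption on the high-conductivity region of the coarse element `K`, with threshold `ρ`
and constants `c₀`, `c₁`. -/
structure HighConductivityAssumption (Tf : Mesh) (α : Finset Plane → ℝ) (K : Finset Plane)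
    (ρ c₀ c₁ : ℝ) : Prop where
  /-- the distance of `K^I(ρ)` and `K^B(ρ)` is at least `h` -/
  separated : ∀ x ∈ interiorPart Tf α K ρ, ∀ y ∈ boundaryPart Tf α K ρ, meshSize Tf ≤ dist x y
  /-- the coefficient is constant on each component of `K^B(ρ)` -/
  constant : ∀ C ∈ boundaryComponents Tf α K ρ, ∃ a : ℝ,
    ∀ τ ∈ fineElements Tf K, ρ < α τ → hull τ ⊆ C → α τ = a
  /-- each component of `K^B(ρ)` meets the boundary of `K` in a connected set -/
  contact : ∀ C ∈ boundaryComponents Tf α K ρ, IsConnected (C ∩ frontier (hull K))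
  /-- on each edge of `K`, a part of length at least `c₀ * H_K` lies outside `K^B(ρ)` -/
  uncovered : ∀ q ∈ K, ∀ r ∈ K, q ≠ r →
    ENNReal.ofReal (c₀ * Metric.diam (hull K)) ≤
      μH[1] (segment ℝ q r \ (boundaryPart Tf α K ρ ∩ frontier (hull K)))
  /-- the perimeter of `K^B(ρ)` is at most `c₁ * H_K` -/
  perimeter : μH[1] (frontier (boundaryPart Tf α K ρ)) ≤
    ENNReal.ofReal (c₁ * Metric.diam (hull K))

end MSFEM

end

/-! A basis function minimises the energy among all functions of S^h(K) with its boundary data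
(`IsMultiscaleBasis.energy_le`), so it suffices to exhibit one competitor of energy O(ρ H/h)
(`exists_test_function`). Its nodal values are the boundary data on ∂K, a Lipschitz extension of
them on each component of K^B(ρ), and 0 at all other nodes.

Elements with α ≤ ρ: the nodal values lie in [0,1], and in two dimensions |∇u|² times the area is
then bounded independently of the element size, so each element costs O(ρ). Only elements with a
vertex on ∂K or in K^B(ρ) contribute. The lengths of ∂K and of the boundary of K^B(ρ) are O(H), so
quasi-uniformity leaves O(H/h) such elements (`card_mul_meshSize_le`).

A component C of K^B(ρ), with α = a > ρ: an edge has total resistance ∫ α⁻¹ ≥ c₀ H_K / ρ, because α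
≤ ρ on its uncovered part, whereas a piece of length d inside C contributes only d/a. Hence the data
on the contact set are Lipschitz with constant O(ρ/(a H_K)) (`abs_oscData_sub_le`), and a (ρ/(a
H_K))² ≤ ρ/H_K². The sum over K is O(ρ), whatever the contrast. Connectedness of the contact sets
enters here: two contact points on one edge have the whole piece between them in C
(`segment_subset_component`), and a contact set meeting two edges contains their common vertex
(`vertex_mem_component`).

High components away from ∂K cost nothing, since the competitor vanishes at all their nodes. The
same competitor, minus an orthogonal projection, yields existence (`exists_isMultiscaleBasis`). -/

noncomputable section

namespace MSFEM

/-! ### Triangles and barycentric coordinates -/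

/-- Three affinely independent points of the plane. -/
structure IsTriangle (τ : Finset Plane) : Prop where
  indep : AffineIndependent ℝ ((↑) : τ → Plane)
  card : τ.card = 3

lemma isTriangle_of_mem_elements {T : Mesh} {τ : Finset Plane} (h : τ ∈ elements T) :
    IsTriangle τ :=
  ⟨T.indep h.1, h.2⟩

/-- The vertices of a triangle, as an affine basis of the plane. -/
def IsTriangle.basis {τ : Finset Plane} (h : IsTriangle τ) : AffineBasis τ ℝ Plane :=
  ⟨(↑), h.indep, by
    rw [h.indep.affineSpan_eq_top_iff_card_eq_finrank_add_one]
    simp [h.card]⟩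

open Classical in
/-- The barycentric coordinate of the vertex `v` of the triangle `τ`. -/
def baryCoord (τ : Finset Plane) (v : Plane) : Plane →ᵃ[ℝ] ℝ :=
  if h : IsTriangle τ ∧ v ∈ τ then h.1.basis.coord ⟨v, h.2⟩ else 0

namespace IsTriangle

variable {τ : Finset Plane} {v w x : Plane}

lemma baryCoord_eq (h : IsTriangle τ) (hv : v ∈ τ) :
    baryCoord τ v = h.basis.coord ⟨v, hv⟩ := by
  simp [baryCoord, h, hv]

lemma baryCoord_self (h : IsTriangle τ) (hv : v ∈ τ) : baryCoord τ v v = 1 := by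
  rw [h.baryCoord_eq hv]
  exact h.basis.coord_apply_eq ⟨v, hv⟩

lemma baryCoord_ne (h : IsTriangle τ) (hv : v ∈ τ) (hw : w ∈ τ) (hvw : v ≠ w) :
    baryCoord τ v w = 0 := by
  rw [h.baryCoord_eq hv]
  exact h.basis.coord_apply_ne (i := ⟨v, hv⟩) (j := ⟨w, hw⟩) (by simpa using hvw)

lemma sum_baryCoord (h : IsTriangle τ) (x : Plane) : ∑ v ∈ τ, baryCoord τ v x = 1 := by
  rw [← Finset.sum_attach, ← h.basis.sum_coord_apply_eq_one x]
  exact Finset.sum_congr rfl fun v _ => by rw [h.baryCoord_eq v.2]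

lemma sum_baryCoord_smul (h : IsTriangle τ) (x : Plane) :
    ∑ v ∈ τ, baryCoord τ v x • v = x := by
  rw [← Finset.sum_attach]
  conv_rhs => rw [← h.basis.linear_combination_coord_eq_self x]
  exact Finset.sum_congr rfl fun v _ => by rw [h.baryCoord_eq v.2]; rfl

lemma affine_apply (h : IsTriangle τ) (g : Plane →ᵃ[ℝ] ℝ) (x : Plane) :
    g x = ∑ v ∈ τ, baryCoord τ v x * g v := by
  conv_lhs => rw [← h.sum_baryCoord_smul x]
  have := Finset.map_affineCombination τ (fun v => v) (fun v => baryCoord τ v x)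
    (h.sum_baryCoord x) g
  rw [Finset.affineCombination_eq_linear_combination _ _ _ (h.sum_baryCoord x),
    Finset.affineCombination_eq_linear_combination _ _ _ (h.sum_baryCoord x)] at this
  simpa using this

lemma mem_hull_iff (h : IsTriangle τ) : x ∈ hull τ ↔ ∀ v ∈ τ, 0 ≤ baryCoord τ v x := by
  have : (τ : Set Plane) = range h.basis := by
    change _ = range ((↑) : τ → Plane)
    simp
  rw [hull, this, AffineBasis.convexHull_eq_nonneg_coord]
  simp only [mem_ofPred_eq, Subtype.forall]
  exact forall₂_congr fun v hv => by rw [h.baryCoord_eq hv]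

lemma mem_interior_hull_iff (h : IsTriangle τ) :
    x ∈ interior (hull τ) ↔ ∀ v ∈ τ, 0 < baryCoord τ v x := by
  have : (τ : Set Plane) = range h.basis := by
    change _ = range ((↑) : τ → Plane)
    simp
  rw [hull, this, AffineBasis.interior_convexHull]
  simp only [mem_ofPred_eq, Subtype.forall]
  exact forall₂_congr fun v hv => by rw [h.baryCoord_eq hv]

lemma isCompact_hull (τ : Finset Plane) : IsCompact (hull τ) :=
  τ.finite_toSet.isCompact_convexHull ℝ

lemma isClosed_hull (τ : Finset Plane) : IsClosed (hull τ) := (isCompact_hull τ).isClosed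

lemma mem_frontier_hull_iff (h : IsTriangle τ) :
    x ∈ frontier (hull τ) ↔ x ∈ hull τ ∧ ∃ v ∈ τ, baryCoord τ v x = 0 := by
  rw [(isClosed_hull τ).frontier_eq, mem_sdiff, and_congr_right_iff, h.mem_interior_hull_iff]
  intro hx
  rw [h.mem_hull_iff] at hx
  push Not
  constructor
  · rintro ⟨v, hv, h0⟩
    exact ⟨v, hv, le_antisymm h0 (hx v hv)⟩
  · rintro ⟨v, hv, h0⟩
    exact ⟨v, hv, h0.le⟩

lemma nonempty (h : IsTriangle τ) : τ.Nonempty :=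
  Finset.card_pos.1 (by rw [h.card]; norm_num)

lemma interior_hull_nonempty (h : IsTriangle τ) : (interior (hull τ)).Nonempty := by
  have : (τ : Set Plane) = range h.basis := by
    change _ = range ((↑) : τ → Plane)
    simp
  rw [hull, interior_convexHull_nonempty_iff_affineSpan_eq_top, this]
  exact h.basis.tot

lemma closure_interior_hull (h : IsTriangle τ) : closure (interior (hull τ)) = hull τ := by
  rw [(convex_convexHull ℝ _).closure_interior_eq_closure_of_nonempty_interior
    h.interior_hull_nonempty, (isClosed_hull τ).closure_eq]

lemma diam_pos (h : IsTriangle τ) : 0 < Metric.diam (hull τ) := by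
  have hc : 1 < τ.card := by rw [h.card]; norm_num
  obtain ⟨a, ha, b, hb, hab⟩ := Finset.one_lt_card.1 hc
  exact (dist_pos.2 hab).trans_le (Metric.dist_le_diam_of_mem (isCompact_hull τ).isBounded
    (subset_convexHull ℝ _ ha) (subset_convexHull ℝ _ hb))

lemma baryCoord_le_one (h : IsTriangle τ) (hx : x ∈ hull τ) (hv : v ∈ τ) :
    baryCoord τ v x ≤ 1 := by
  rw [← h.sum_baryCoord x]
  exact Finset.single_le_sum (f := fun v => baryCoord τ v x) (h.mem_hull_iff.1 hx) hv

lemma ext_baryCoord (h : IsTriangle τ) {y : Plane}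
    (hxy : ∀ v ∈ τ, baryCoord τ v x = baryCoord τ v y) : x = y := by
  rw [← h.sum_baryCoord_smul x, ← h.sum_baryCoord_smul y]
  exact Finset.sum_congr rfl fun v hv => by rw [hxy v hv]

/-- A point of the triangle lies in the hull of those vertices whose coordinate is nonzero. -/
lemma mem_hull_of_baryCoord_eq_zero (h : IsTriangle τ) {s : Finset Plane}
    (hx : x ∈ hull τ) (hs : ∀ v ∈ τ, v ∉ s → baryCoord τ v x = 0) : x ∈ hull s := by
  classical
  have hx' := h.mem_hull_iff.1 hx
  have h1 : ∑ v ∈ τ ∩ s, baryCoord τ v x = 1 := by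
    rw [← h.sum_baryCoord x]
    refine Finset.sum_subset Finset.inter_subset_left fun v hv hv' => hs v hv ?_
    intro hvs
    exact hv' (Finset.mem_inter.2 ⟨hv, hvs⟩)
  have h2 : ∑ v ∈ τ ∩ s, baryCoord τ v x • v = x := by
    conv_rhs => rw [← h.sum_baryCoord_smul x]
    refine Finset.sum_subset Finset.inter_subset_left fun v hv hv' => ?_
    rw [hs v hv fun hvs => hv' (Finset.mem_inter.2 ⟨hv, hvs⟩), zero_smul]
  rw [← h2]
  refine (convex_convexHull ℝ _).sum_mem (fun v hv => hx' v (Finset.mem_inter.1 hv).1) h1 ?_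
  exact fun v hv => subset_convexHull ℝ _ (Finset.mem_inter.1 hv).2

/-- Coordinates vanish on the opposite face. -/
lemma baryCoord_eq_zero_of_mem_hull (h : IsTriangle τ) {s : Set Plane} (hs : s ⊆ τ)
    (hv : v ∈ τ) (hvs : v ∉ s) (hx : x ∈ convexHull ℝ s) : baryCoord τ v x = 0 := by
  have : convexHull ℝ s ⊆ {y | baryCoord τ v y = 0} := by
    refine convexHull_min (fun w hw => ?_) ?_
    · refine h.baryCoord_ne hv (hs hw) ?_
      rintro rfl
      exact hvs hw
    · exact (convex_singleton (𝕜 := ℝ) (0 : ℝ)).affine_preimage (baryCoord τ v)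
  exact this hx

end IsTriangle

/-! ### Slopes of affine functions -/

/-- The constant gradient of an affine function. -/
def affGrad : (Plane →ᵃ[ℝ] ℝ) →ₗ[ℝ] Plane where
  toFun g := (InnerProductSpace.toDual ℝ Plane).symm (LinearMap.toContinuousLinearMap g.linear)
  map_add' g g' := by simp
  map_smul' c g := by simp

lemma inner_affGrad (g : Plane →ᵃ[ℝ] ℝ) (x y : Plane) :
    inner ℝ (affGrad g) (x - y) = g x - g y := by
  simp only [affGrad, LinearMap.coe_mk, AddHom.coe_mk, InnerProductSpace.toDual_symm_apply]
  exact g.linearMap_vsub x y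

lemma hasGradientAt_affine (g : Plane →ᵃ[ℝ] ℝ) (x : Plane) : HasGradientAt g (affGrad g) x := by
  rw [hasGradientAt_iff_hasFDerivAt]
  have h : (InnerProductSpace.toDual ℝ Plane) (affGrad g)
      = LinearMap.toContinuousLinearMap g.linear := by simp [affGrad]
  rw [h]
  have h2 : (g : Plane → ℝ) = fun y => LinearMap.toContinuousLinearMap g.linear y + g 0 := by
    ext y
    have := g.linearMap_vsub y 0
    simp at this ⊢
    linarith
  rw [h2]
  exact (LinearMap.toContinuousLinearMap g.linear).hasFDerivAt.add_const _

lemma abs_affine_sub_le (g : Plane →ᵃ[ℝ] ℝ) (x y : Plane) :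
    |g x - g y| ≤ ‖affGrad g‖ * dist x y := by
  rw [← inner_affGrad, dist_eq_norm]
  exact abs_real_inner_le_norm _ _

/-- An affine function with oscillation at most `M` on a disc of radius `r` has slope at most
`M / (2 * r)`, in particular at most `M / r`. -/
lemma norm_affGrad_le {g : Plane →ᵃ[ℝ] ℝ} {s : Set Plane} {x : Plane} {r M : ℝ} (hr : 0 < r)
    (hs : Metric.closedBall x r ⊆ s) (hM : ∀ y ∈ s, ∀ z ∈ s, g y - g z ≤ M) :
    ‖affGrad g‖ ≤ M / r := by
  have hM0 : 0 ≤ M := by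
    simpa using hM x (hs (Metric.mem_closedBall_self hr.le)) x (hs (Metric.mem_closedBall_self hr.le))
  by_cases h0 : affGrad g = 0
  · rw [h0, norm_zero]; positivity
  have hn : 0 < ‖affGrad g‖ := norm_pos_iff.2 h0
  -- The extremal point: distance r from the centre in the direction of steepest ascent.
  have hy : x + (r / ‖affGrad g‖) • affGrad g ∈ Metric.closedBall x r := by
    rw [Metric.mem_closedBall, dist_eq_norm, add_sub_cancel_left, norm_smul, Real.norm_eq_abs,
      abs_of_pos (by positivity)]
    field_simp
    exact le_rfl
  have := hM _ (hs hy) x (hs (Metric.mem_closedBall_self hr.le))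
  rw [← inner_affGrad, add_sub_cancel_left, inner_smul_right, real_inner_self_eq_norm_sq] at this
  rw [le_div_iff₀ hr]
  calc ‖affGrad g‖ * r = r / ‖affGrad g‖ * ‖affGrad g‖ ^ 2 := by field_simp
    _ ≤ M := this

/-- Half-planes are convex, so a bound at the vertices passes to the hull, first in one argument and
then in the other. -/
lemma affine_sub_le {τ : Finset Plane} {g : Plane →ᵃ[ℝ] ℝ} {M : ℝ}
    (hM : ∀ v ∈ τ, ∀ w ∈ τ, g v - g w ≤ M) {y z : Plane} (hy : y ∈ hull τ) (hz : z ∈ hull τ) :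
    g y - g z ≤ M := by
  have key : ∀ w ∈ τ, hull τ ⊆ {y | g y ≤ g w + M} := fun w hw =>
    convexHull_min (fun v hv => by have := hM v hv w hw; simp only [mem_ofPred_eq]; linarith)
      ((convex_Iic (g w + M)).affine_preimage g)
  have : hull τ ⊆ {z | g y - M ≤ g z} :=
    convexHull_min (fun w hw => by
      have : g y ≤ g w + M := key w hw hy
      simp only [mem_ofPred_eq]; linarith)
      ((convex_Ici (g y - M)).affine_preimage g)
  have : g y - M ≤ g z := this hz
  linarith

/-- Slope bound on a triangle that contains a disc of radius `diam / σ`. -/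
lemma IsTriangle.norm_affGrad_le {τ : Finset Plane} (h : IsTriangle τ) {σ M : ℝ} (hσ : 0 < σ)
    (hreg : ∃ x, Metric.closedBall x (Metric.diam (hull τ) / σ) ⊆ hull τ) {g : Plane →ᵃ[ℝ] ℝ}
    (hM : ∀ v ∈ τ, ∀ w ∈ τ, g v - g w ≤ M) :
    ‖affGrad g‖ ≤ σ * M / Metric.diam (hull τ) := by
  obtain ⟨x, hx⟩ := hreg
  have := MSFEM.norm_affGrad_le (div_pos h.diam_pos hσ) hx
    (fun y hy z hz => affine_sub_le hM hy hz)
  calc _ ≤ _ := this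
    _ = _ := by field_simp

/-- The slope of a coordinate is the reciprocal of a height, so this is shape regularity in usable
form: it later bounds side lengths and angles from below. -/
lemma IsTriangle.norm_affGrad_baryCoord_le {τ : Finset Plane} (h : IsTriangle τ) {σ : ℝ}
    (hσ : 0 < σ) (hreg : ∃ x, Metric.closedBall x (Metric.diam (hull τ) / σ) ⊆ hull τ)
    {v : Plane} (hv : v ∈ τ) : ‖affGrad (baryCoord τ v)‖ ≤ σ / Metric.diam (hull τ) := by
  have := h.norm_affGrad_le hσ hreg (g := baryCoord τ v) (M := 1) fun w hw w' hw' => by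
    have h1 := h.baryCoord_le_one (subset_convexHull ℝ _ hw) hv
    have h2 := h.mem_hull_iff.1 (subset_convexHull ℝ _ hw') v hv
    linarith
  simpa using this

/-! ### Nodal interpolation on a triangle -/

/-- The affine function on the triangle `τ` with prescribed values at the vertices. -/
def interp (τ : Finset Plane) : (Plane → ℝ) →ₗ[ℝ] (Plane →ᵃ[ℝ] ℝ) where
  toFun f := ∑ v ∈ τ, f v • baryCoord τ v
  map_add' f g := by simp [add_smul, Finset.sum_add_distrib]
  map_smul' c f := by simp [mul_smul, Finset.smul_sum]

lemma interp_apply (τ : Finset Plane) (f : Plane → ℝ) (x : Plane) :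
    interp τ f x = ∑ v ∈ τ, f v * baryCoord τ v x := by
  have : ∀ (s : Finset Plane), (∑ v ∈ s, f v • baryCoord τ v) x = ∑ v ∈ s, f v * baryCoord τ v x := by
    classical
    intro s
    induction s using Finset.induction_on with
    | empty => simp
    | insert a s ha ih =>
      rw [Finset.sum_insert ha, Finset.sum_insert ha, ← ih]
      rfl
  exact this τ

lemma IsTriangle.interp_eq {τ : Finset Plane} (h : IsTriangle τ) {f : Plane → ℝ}
    {g : Plane →ᵃ[ℝ] ℝ} (hfg : ∀ v ∈ τ, f v = g v) : interp τ f = g := by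
  ext x
  rw [interp_apply, h.affine_apply g]
  exact Finset.sum_congr rfl fun v hv => by rw [hfg v hv, mul_comm]

lemma IsTriangle.interp_vertex {τ : Finset Plane} (h : IsTriangle τ) (f : Plane → ℝ)
    {v : Plane} (hv : v ∈ τ) : interp τ f v = f v := by
  rw [interp_apply, Finset.sum_eq_single v]
  · rw [h.baryCoord_self hv, mul_one]
  · intro w hw hwv
    rw [h.baryCoord_ne hw hv hwv, mul_zero]
  · exact fun h' => (h' hv).elim

/-! ### Elements of a mesh -/

lemma mem_hull_inter {T : Mesh} {τ τ' : Finset Plane} (hτ : τ ∈ elements T) (hτ' : τ' ∈ elements T)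
    {x : Plane} (hx : x ∈ hull τ) (hx' : x ∈ hull τ') :
    x ∈ convexHull ℝ ((τ : Set Plane) ∩ τ') :=
  T.inter_subset_convexHull hτ.1 hτ'.1 ⟨hx, hx'⟩

lemma exists_mem_notMem {T : Mesh} {τ τ' : Finset Plane} (hτ : τ ∈ elements T)
    (hτ' : τ' ∈ elements T) (hne : τ ≠ τ') : ∃ v ∈ τ, v ∉ τ' := by
  by_contra! h
  exact hne (Finset.eq_of_subset_of_card_le h (by rw [hτ.2, hτ'.2]))

/-- By conformity a common point lies in the hull of the shared vertices, where the coordinate of an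
unshared vertex of τ vanishes; in the interior it is positive. -/
lemma disjoint_interior_hull {T : Mesh} {τ τ' : Finset Plane} (hτ : τ ∈ elements T)
    (hτ' : τ' ∈ elements T) (hne : τ ≠ τ') : Disjoint (interior (hull τ)) (hull τ') := by
  rw [Set.disjoint_left]
  intro x hx hx'
  obtain ⟨v, hv, hv'⟩ := exists_mem_notMem hτ hτ' hne
  have h := isTriangle_of_mem_elements hτ
  have h0 := h.baryCoord_eq_zero_of_mem_hull inter_subset_left hv (fun h => hv' h.2)
    (mem_hull_inter hτ hτ' (interior_subset hx) hx')
  have := h.mem_interior_hull_iff.1 hx v hv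
  linarith

/-- The geometric situation inside a coarse element: it is a triangle covered by finitely many
fine elements. -/
structure IsRefined (Tf : Mesh) (K : Finset Plane) : Prop where
  triangle : IsTriangle K
  finite : (fineElements Tf K).Finite
  cover : hull K ⊆ ⋃ τ ∈ fineElements Tf K, hull τ

lemma finite_elements {T : Mesh} {D : Set Plane} (hT : IsTriangulation T D) :
    (elements T).Finite :=
  hT.finite.subset fun _ h => h.1

lemma exists_element_of_mem {T : Mesh} {D : Set Plane} (hT : IsTriangulation T D) {x : Plane}
    (hx : x ∈ D) : ∃ τ ∈ elements T, x ∈ hull τ := by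
  rw [← hT.space_eq, Geometry.SimplicialComplex.mem_space_iff] at hx
  obtain ⟨s, hs, hxs⟩ := hx
  obtain ⟨t, ht, hst⟩ := hT.pure s hs
  exact ⟨t, ht, convexHull_mono (by exact_mod_cast hst) hxs⟩

/-- A fine element through an interior point of K has a coarse parent, which must be K because other
coarse elements miss that interior. Taking closures then covers the boundary as well. -/
lemma isRefined {Tf Tc : Mesh} {D : Set Plane} (hf : IsTriangulation Tf D)
    (hc : IsTriangulation Tc D) (ha : Aligned Tf Tc) {K : Finset Plane} (hK : K ∈ elements Tc) :
    IsRefined Tf K := by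
  have hfin : (fineElements Tf K).Finite := (finite_elements hf).subset fun _ h => h.1
  have htri := isTriangle_of_mem_elements hK
  refine ⟨htri, hfin, ?_⟩
  rw [← htri.closure_interior_hull]
  refine closure_minimal (fun x hx => ?_)
    (hfin.isClosed_biUnion fun τ _ => IsTriangle.isClosed_hull τ)
  have hxD : x ∈ D := by
    rw [← hc.space_eq]
    exact Geometry.SimplicialComplex.convexHull_subset_space hK.1 (interior_subset hx)
  obtain ⟨τ, hτ, hxτ⟩ := exists_element_of_mem hf hxD
  obtain ⟨K', hK', hsub⟩ := ha τ hτ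
  have : K = K' := by
    by_contra hne
    exact Set.disjoint_left.1 (disjoint_interior_hull hK hK' hne) hx (hsub hxτ)
  subst this
  exact mem_biUnion (x := τ) ⟨hτ, hsub⟩ hxτ

lemma IsRefined.exists_mem {Tf : Mesh} {K : Finset Plane} (h : IsRefined Tf K) {x : Plane}
    (hx : x ∈ hull K) : ∃ τ ∈ fineElements Tf K, x ∈ hull τ := by
  simpa using h.cover hx

/-! ### Elements that meet a boundary line -/

/-- A triangle on one side of the line g = 0 that meets it in two points has a whole edge on it. So
g is a multiple of the coordinate of the vertex x off the line, and the midpoint of the two points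
is relatively interior to that edge. -/
lemma IsTriangle.exists_opposite {τ : Finset Plane} (h : IsTriangle τ) {g : Plane →ᵃ[ℝ] ℝ}
    (hg : ∀ v ∈ τ, 0 ≤ g v) (hg0 : g ≠ 0) {y z : Plane} (hy : y ∈ hull τ) (hz : z ∈ hull τ)
    (hyz : y ≠ z) (gy : g y = 0) (gz : g z = 0) :
    ∃ x ∈ τ, 0 < g x ∧ (∀ p, g p = baryCoord τ x p * g x) ∧
      ∀ v ∈ τ, v ≠ x → 0 < baryCoord τ v (midpoint ℝ y z) := by
  classical
  have : ∃ x ∈ τ, 0 < g x := by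
    by_contra! hc
    apply hg0
    ext p
    rw [h.affine_apply g p]
    exact Finset.sum_eq_zero fun v hv => by rw [le_antisymm (hc v hv) (hg v hv), mul_zero]
  obtain ⟨x, hx, hgx⟩ := this
  obtain ⟨v, w, hvw, he⟩ := Finset.card_eq_two.1
    (show (τ.erase x).card = 2 by rw [Finset.card_erase_of_mem hx, h.card])
  have hτ : τ = insert x {v, w} := by rw [← he, Finset.insert_erase hx]
  have hv : v ∈ τ ∧ v ≠ x := by
    have : v ∈ τ.erase x := by rw [he]; simp
    exact ⟨(Finset.mem_erase.1 this).2, (Finset.mem_erase.1 this).1⟩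
  have hw : w ∈ τ ∧ w ≠ x := by
    have : w ∈ τ.erase x := by rw [he]; simp
    exact ⟨(Finset.mem_erase.1 this).2, (Finset.mem_erase.1 this).1⟩
  have hsum : ∀ f : Plane → ℝ, ∑ u ∈ τ, f u = f x + (f v + f w) := fun f => by
    rw [hτ, Finset.sum_insert (by rw [← he]; simp), Finset.sum_pair hvw]
  have hone : ∀ p, baryCoord τ x p + (baryCoord τ v p + baryCoord τ w p) = 1 := fun p => by
    rw [← hsum fun u => baryCoord τ u p, h.sum_baryCoord]
  have hgp : ∀ p, g p = baryCoord τ x p * g x + (baryCoord τ v p * g v + baryCoord τ w p * g w) :=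
    fun p => by rw [← hsum fun u => baryCoord τ u p * g u, h.affine_apply]
  have hext : ∀ p q, baryCoord τ x p = baryCoord τ x q → baryCoord τ v p = baryCoord τ v q →
      p = q := fun p q h1 h2 => by
    refine h.ext_baryCoord fun u hu => ?_
    have h3 := hone p
    have h4 := hone q
    rw [hτ] at hu
    simp only [Finset.mem_insert, Finset.mem_singleton] at hu
    rcases hu with rfl | rfl | rfl <;> linarith
  have hzero : ∀ p ∈ hull τ, g p = 0 →
      baryCoord τ x p = 0 ∧ (baryCoord τ v p * g v = 0) ∧ baryCoord τ w p * g w = 0 := by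
    intro p hp hp0
    have hp' := h.mem_hull_iff.1 hp
    have h1 := mul_nonneg (hp' x hx) hgx.le
    have h2 := mul_nonneg (hp' v hv.1) (hg v hv.1)
    have h3 := mul_nonneg (hp' w hw.1) (hg w hw.1)
    have h4 := hgp p
    have h5 : baryCoord τ x p * g x = 0 := by linarith
    exact ⟨(mul_eq_zero.1 h5).resolve_right hgx.ne', by linarith, by linarith⟩
  obtain ⟨y1, y2, y3⟩ := hzero y hy gy
  obtain ⟨z1, z2, z3⟩ := hzero z hz gz
  have hy1 := hone y
  have hz1 := hone z
  -- If g did not vanish at v, only the vertex w could lie on the line, which would force y = z.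
  have gv : g v = 0 := by
    by_contra h0
    have a := (mul_eq_zero.1 y2).resolve_right h0
    have b := (mul_eq_zero.1 z2).resolve_right h0
    exact hyz (hext y z (y1.trans z1.symm) (a.trans b.symm))
  have gw : g w = 0 := by
    by_contra h0
    have a := (mul_eq_zero.1 y3).resolve_right h0
    have b := (mul_eq_zero.1 z3).resolve_right h0
    exact hyz (hext y z (y1.trans z1.symm) (by linarith))
  refine ⟨x, hx, hgx, fun p => by rw [hgp p, gv, gw]; ring, fun u hu hux => ?_⟩
  have hy' := h.mem_hull_iff.1 hy
  have hz' := h.mem_hull_iff.1 hz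
  have hu' : u = v ∨ u = w := by
    rw [hτ] at hu
    simp only [Finset.mem_insert, Finset.mem_singleton] at hu
    exact hu.resolve_left hux
  rw [AffineMap.map_midpoint, midpoint_eq_smul_add, smul_eq_mul]
  have a1 := hy' u hu
  have a2 := hz' u hu
  by_contra hc
  have a3 : baryCoord τ u y = 0 := by
    have : baryCoord τ u y + baryCoord τ u z ≤ 0 := by
      by_contra! h'
      exact hc (by simp only [invOf_eq_inv]; positivity)
    linarith
  have a4 : baryCoord τ u z = 0 := by
    have : baryCoord τ u y + baryCoord τ u z ≤ 0 := by
      by_contra! h'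
      exact hc (by simp only [invOf_eq_inv]; positivity)
    linarith
  rcases hu' with rfl | rfl
  · exact hyz (hext y z (y1.trans z1.symm) (a3.trans a4.symm))
  · exact hyz (hext y z (y1.trans z1.symm) (by linarith))

/-- Two different elements on the same side of a line share at most one point of the line. -/
lemma eq_of_mem_line {T : Mesh} {τ τ' : Finset Plane} (hτ : τ ∈ elements T)
    (hτ' : τ' ∈ elements T) (hne : τ ≠ τ') {g : Plane →ᵃ[ℝ] ℝ} (hg0 : g ≠ 0)
    (hg : ∀ v ∈ τ, 0 ≤ g v) (hg' : ∀ v ∈ τ', 0 ≤ g v) {y z : Plane}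
    (hy : y ∈ hull τ) (hy' : y ∈ hull τ') (hz : z ∈ hull τ) (hz' : z ∈ hull τ')
    (gy : g y = 0) (gz : g z = 0) : y = z := by
  by_contra hyz
  have h := isTriangle_of_mem_elements hτ
  have h' := isTriangle_of_mem_elements hτ'
  obtain ⟨x, hx, hgx, hgp, hpos⟩ := h.exists_opposite hg hg0 hy hz hyz gy gz
  obtain ⟨x', hx', hgx', hgp', hpos'⟩ := h'.exists_opposite hg' hg0 hy' hz' hyz gy gz
  obtain ⟨c, hc⟩ := h.interior_hull_nonempty
  have hc' := h.mem_interior_hull_iff.1 hc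
  set m := midpoint ℝ y z with hm
  have hmτ : m ∈ hull τ := (convex_convexHull ℝ _).midpoint_mem hy hz
  have hm' := h.mem_hull_iff.1 hmτ
  have gm : g m = 0 := by rw [hm, AffineMap.map_midpoint, gy, gz, midpoint_self]
  have hxm : baryCoord τ' x' m = 0 :=
    (mul_eq_zero.1 ((hgp' m).symm.trans gm)).resolve_right hgx'.ne'
  have hxc : 0 < baryCoord τ' x' c := by
    have h1 : 0 < g c := by rw [hgp c]; exact mul_pos (hc' x hx) hgx
    rw [hgp' c] at h1
    exact pos_of_mul_pos_left h1 hgx'.le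
  -- Moving from m towards the interior point c of τ enters the interior of τ': the coordinate of x'
  -- starts at 0 and grows because g is positive at c, and the others are positive at m already. The
  -- same points stay in τ by convexity, contradicting disjointness of interiors.
  have hev : ∀ᶠ ε in nhdsWithin (0 : ℝ) (Ioi 0),
      ∀ v ∈ τ', 0 < baryCoord τ' v (AffineMap.lineMap m c ε) := by
    rw [Filter.eventually_all_finset]
    intro v hv
    by_cases hvx : v = x'
    · subst hvx
      filter_upwards [self_mem_nhdsWithin] with ε hε
      rw [AffineMap.apply_lineMap, hxm, AffineMap.lineMap_apply]
      simp only [vsub_eq_sub, sub_zero, smul_eq_mul, vadd_eq_add, add_zero]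
      exact mul_pos hε hxc
    · have hcont : Continuous fun ε : ℝ => baryCoord τ' v (AffineMap.lineMap m c ε) :=
        (baryCoord τ' v).continuous_of_finiteDimensional.comp AffineMap.lineMap_continuous
      have := hcont.tendsto 0
      rw [AffineMap.lineMap_apply_zero] at this
      exact nhdsWithin_le_nhds (this.eventually (lt_mem_nhds (hpos' v hv hvx)))
  have hev2 : ∀ᶠ ε in nhdsWithin (0 : ℝ) (Ioi 0), ε ∈ Ioo (0 : ℝ) 1 :=
    Ioo_mem_nhdsGT one_pos
  obtain ⟨ε, h1, h2⟩ := (hev.and hev2).exists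
  have hi' : AffineMap.lineMap m c ε ∈ interior (hull τ') := h'.mem_interior_hull_iff.2 h1
  have hi : AffineMap.lineMap m c ε ∈ hull τ := h.mem_hull_iff.2 fun v hv => by
    rw [AffineMap.apply_lineMap, AffineMap.lineMap_apply_module]
    simp only [smul_eq_mul]
    have := hm' v hv
    have := hc' v hv
    have : 0 ≤ 1 - ε := by linarith [h2.2]
    have := h2.1
    positivity
  exact Set.disjoint_left.1 (disjoint_interior_hull hτ' hτ hne.symm) hi' hi

/-- A point of a triangle on a supporting line lies in the hull of the vertices on that line. -/
lemma IsTriangle.mem_hull_of_affine_eq_zero {τ : Finset Plane} (h : IsTriangle τ)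
    {g : Plane →ᵃ[ℝ] ℝ} (hg : ∀ v ∈ τ, 0 ≤ g v) {x : Plane} (hx : x ∈ hull τ) (gx : g x = 0) :
    ∀ v ∈ τ, g v ≠ 0 → baryCoord τ v x = 0 := by
  intro v hv hgv
  rw [h.affine_apply g] at gx
  rw [Finset.sum_eq_zero_iff_of_nonneg fun v hv => mul_nonneg (h.mem_hull_iff.1 hx v hv) (hg v hv)]
    at gx
  exact (mul_eq_zero.1 (gx v hv)).resolve_right hgv

/-! ### The space `S^h(K)` and nodal values -/

/-- Both interpolants agree at the shared vertices, hence on their hull, which by conformity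
contains the intersection. This makes the piecewise definition below independent of the chosen
element, and continuous. -/
lemma interp_eqOn_inter {T : Mesh} {τ τ' : Finset Plane} (hτ : τ ∈ elements T)
    (hτ' : τ' ∈ elements T) (f : Plane → ℝ) {x : Plane} (hx : x ∈ hull τ) (hx' : x ∈ hull τ') :
    interp τ f x = interp τ' f x := by
  have h := isTriangle_of_mem_elements hτ
  have h' := isTriangle_of_mem_elements hτ'
  have hsub : convexHull ℝ ((τ : Set Plane) ∩ τ') ⊆ {y | (interp τ f - interp τ' f) y = 0} :=
    convexHull_min (fun v hv => by
      change interp τ f v - interp τ' f v = 0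
      rw [h.interp_vertex f hv.1, h'.interp_vertex f hv.2, sub_self])
      ((convex_singleton (𝕜 := ℝ) (0 : ℝ)).affine_preimage (interp τ f - interp τ' f))
  have : interp τ f x - interp τ' f x = 0 := hsub (mem_hull_inter hτ hτ' hx hx')
  linarith

open Classical in
/-- The continuous piecewise affine function on `K` with given values at the fine vertices. -/
def nodalInterp (Tf : Mesh) (K : Finset Plane) (f : Plane → ℝ) (x : Plane) : ℝ :=
  if h : ∃ τ ∈ fineElements Tf K, x ∈ hull τ then interp h.choose f x else 0

lemma nodalInterp_eqOn {Tf : Mesh} {K τ : Finset Plane} (f : Plane → ℝ)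
    (hτ : τ ∈ fineElements Tf K) : EqOn (nodalInterp Tf K f) (interp τ f) (hull τ) := by
  intro x hx
  have h : ∃ τ ∈ fineElements Tf K, x ∈ hull τ := ⟨τ, hτ, hx⟩
  rw [nodalInterp, dif_pos h]
  exact interp_eqOn_inter h.choose_spec.1.1 hτ.1 f h.choose_spec.2 hx

lemma isP1_nodalInterp {Tf : Mesh} {K : Finset Plane} (hK : IsRefined Tf K) (f : Plane → ℝ) :
    IsP1 Tf K (nodalInterp Tf K f) := by
  refine ⟨?_, fun τ hτ => ⟨interp τ f, nodalInterp_eqOn f hτ⟩⟩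
  have : Finite (fineElements Tf K) := hK.finite.to_subtype
  have h1 : ContinuousOn (nodalInterp Tf K f) (⋃ τ : fineElements Tf K, hull τ.1) := by
    refine (locallyFinite_of_finite _).continuousOn_iUnion
      (fun τ => IsTriangle.isClosed_hull _) fun τ => ?_
    exact (interp τ.1 f).continuous_of_finiteDimensional.continuousOn.congr
      (nodalInterp_eqOn f τ.2)
  refine h1.mono fun x hx => ?_
  obtain ⟨τ, hτ, hxτ⟩ := hK.exists_mem hx
  exact mem_iUnion.2 ⟨⟨τ, hτ⟩, hxτ⟩

lemma IsP1.eqOn_interp {Tf : Mesh} {K τ : Finset Plane} {u : Plane → ℝ} (hu : IsP1 Tf K u)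
    (hτ : τ ∈ fineElements Tf K) : EqOn u (interp τ u) (hull τ) := by
  obtain ⟨g, hg⟩ := hu.2 τ hτ
  rw [(isTriangle_of_mem_elements hτ.1).interp_eq (g := g)
    fun v hv => hg (subset_convexHull ℝ _ hv)]
  exact hg

lemma IsP1.add {Tf : Mesh} {K : Finset Plane} {u v : Plane → ℝ} (hu : IsP1 Tf K u)
    (hv : IsP1 Tf K v) : IsP1 Tf K (u + v) := by
  refine ⟨hu.1.add hv.1, fun τ hτ => ?_⟩
  obtain ⟨g, hg⟩ := hu.2 τ hτ
  obtain ⟨g', hg'⟩ := hv.2 τ hτ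
  exact ⟨g + g', fun x hx => by simp [hg hx, hg' hx]⟩

lemma IsP1.smul {Tf : Mesh} {K : Finset Plane} {u : Plane → ℝ} (hu : IsP1 Tf K u) (c : ℝ) :
    IsP1 Tf K (c • u) := by
  refine ⟨hu.1.const_smul c, fun τ hτ => ?_⟩
  obtain ⟨g, hg⟩ := hu.2 τ hτ
  exact ⟨c • g, fun x hx => by simp [hg hx]⟩

lemma isP1_zero (Tf : Mesh) (K : Finset Plane) : IsP1 Tf K 0 :=
  ⟨continuousOn_const, fun _ _ => ⟨0, fun _ _ => rfl⟩⟩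

lemma IsP1.sub {Tf : Mesh} {K : Finset Plane} {u v : Plane → ℝ} (hu : IsP1 Tf K u)
    (hv : IsP1 Tf K v) : IsP1 Tf K (u - v) := by
  have := hu.add (hv.smul (-1))
  rwa [neg_one_smul, ← sub_eq_add_neg] at this

/-- The space `S^h_0(K)` as a submodule. -/
def p1Zero (Tf : Mesh) (K : Finset Plane) : Submodule ℝ (Plane → ℝ) where
  carrier := {u | IsP1Zero Tf K u}
  add_mem' hu hv := ⟨hu.1.add hv.1, fun x hx => by simp [hu.2 x hx, hv.2 x hx]⟩
  zero_mem' := ⟨isP1_zero Tf K, fun _ _ => rfl⟩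
  smul_mem' c _ hu := ⟨hu.1.smul c, fun x hx => by simp [hu.2 x hx]⟩

/-! ### The energy form -/

lemma IsP1.gradient_eq {Tf : Mesh} {K τ : Finset Plane} {u : Plane → ℝ} (hu : IsP1 Tf K u)
    (hτ : τ ∈ fineElements Tf K) {x : Plane} (hx : x ∈ interior (hull τ)) :
    gradient u x = affGrad (interp τ u) := by
  refine HasGradientAt.gradient ?_
  refine (hasGradientAt_affine (interp τ u) x).congr_of_eventuallyEq ?_
  filter_upwards [isOpen_interior.mem_nhds hx] with y hy
  exact hu.eqOn_interp hτ (interior_subset hy)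

/-- The area of an element. -/
def area (τ : Finset Plane) : ℝ := volume.real (interior (hull τ))

lemma area_nonneg (τ : Finset Plane) : 0 ≤ area τ := measureReal_nonneg

lemma IsP1.energyForm_eq {Tf : Mesh} {α : Finset Plane → ℝ} {K : Finset Plane} {u v : Plane → ℝ}
    (hK : IsRefined Tf K) (hu : IsP1 Tf K u) (hv : IsP1 Tf K v) :
    energyForm Tf α K u v = ∑ τ ∈ hK.finite.toFinset,
      α τ * area τ * inner ℝ (affGrad (interp τ u)) (affGrad (interp τ v)) := by
  rw [energyForm, finsum_mem_eq_finite_toFinset_sum _ hK.finite]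
  refine Finset.sum_congr rfl fun τ hτ => ?_
  have hτ' : τ ∈ fineElements Tf K := by simpa using hτ
  rw [setIntegral_congr_fun (g := fun _ => inner ℝ (affGrad (interp τ u)) (affGrad (interp τ v)))
    isOpen_interior.measurableSet fun x hx => by
      simp only [hu.gradient_eq hτ' hx, hv.gradient_eq hτ' hx]]
  rw [setIntegral_const, smul_eq_mul, area, mul_assoc]

/-- The scaled elementwise gradients of nodal functions. -/
def gradMap (Tf : Mesh) (α : Finset Plane → ℝ) (K : Finset Plane) :
    (Plane → ℝ) →ₗ[ℝ] PiLp 2 fun _ : fineElements Tf K => Plane :=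
  (WithLp.linearEquiv 2 ℝ (fineElements Tf K → Plane)).symm.toLinearMap ∘ₗ
    LinearMap.pi fun τ : fineElements Tf K => √(α τ.1 * area τ.1) • affGrad ∘ₗ interp τ.1

/-- Turns the energy form into an inner product of a finite-dimensional Euclidean space, so that
discrete harmonicity becomes orthogonality. -/
lemma IsP1.energyForm_eq_inner {Tf : Mesh} {α : Finset Plane → ℝ} {K : Finset Plane}
    [Fintype (fineElements Tf K)] {u v : Plane → ℝ} (hα : ∀ τ ∈ elements Tf, 0 < α τ)
    (hK : IsRefined Tf K) (hu : IsP1 Tf K u) (hv : IsP1 Tf K v) :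
    energyForm Tf α K u v = inner ℝ (gradMap Tf α K u) (gradMap Tf α K v) := by
  rw [hu.energyForm_eq hK hv, PiLp.inner_apply]
  refine Eq.trans ?_ (Finset.sum_subtype hK.finite.toFinset (p := fun τ => τ ∈ fineElements Tf K)
    (by simp) fun τ => inner ℝ (√(α τ * area τ) • affGrad (interp τ u))
      (√(α τ * area τ) • affGrad (interp τ v)))
  refine Finset.sum_congr rfl fun τ hτ => ?_
  have hτ' : τ ∈ fineElements Tf K := by simpa using hτ
  rw [inner_smul_left, inner_smul_right, ← mul_assoc]
  simp only [conj_trivial]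
  rw [Real.mul_self_sqrt (mul_nonneg (hα τ hτ'.1).le (area_nonneg τ))]

/-! ### Existence and energy minimality of basis functions -/

lemma mem_frontier_of_mem_segment {K : Finset Plane} (h : IsTriangle K) {q r x : Plane}
    (hq : q ∈ K) (hr : r ∈ K) (hx : x ∈ segment ℝ q r) : x ∈ frontier (hull K) := by
  classical
  rw [h.mem_frontier_hull_iff]
  refine ⟨(convex_convexHull ℝ _).segment_subset (subset_convexHull ℝ _ hq)
    (subset_convexHull ℝ _ hr) hx, ?_⟩
  have : ∃ v ∈ K, v ∉ ({q, r} : Finset Plane) := by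
    by_contra! hc
    have := (Finset.card_le_card hc).trans Finset.card_le_two
    rw [h.card] at this
    omega
  obtain ⟨v, hv, hvq⟩ := this
  refine ⟨v, hv, h.baryCoord_eq_zero_of_mem_hull (s := {q, r}) ?_ hv (by simpa using hvq)
    (by rwa [convexHull_pair])⟩
  rintro w (rfl | rfl) <;> assumption

lemma exists_mem_segment_of_mem_frontier {K : Finset Plane} (h : IsTriangle K) {x : Plane}
    (hx : x ∈ frontier (hull K)) : ∃ v ∈ K, ∃ q ∈ K, ∃ r ∈ K, q ≠ r ∧ q ≠ v ∧ r ≠ v ∧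
      x ∈ segment ℝ q r := by
  classical
  obtain ⟨hxK, v, hv, hv0⟩ := h.mem_frontier_hull_iff.1 hx
  obtain ⟨q, r, hqr, he⟩ := Finset.card_eq_two.1
    (show (K.erase v).card = 2 by rw [Finset.card_erase_of_mem hv, h.card])
  have hq : q ∈ K.erase v := by rw [he]; simp
  have hr : r ∈ K.erase v := by rw [he]; simp
  refine ⟨v, hv, q, (Finset.mem_erase.1 hq).2, r, (Finset.mem_erase.1 hr).2, hqr,
    (Finset.mem_erase.1 hq).1, (Finset.mem_erase.1 hr).1, ?_⟩
  have := h.mem_hull_of_baryCoord_eq_zero (s := K.erase v) hxK fun w hw hw' => by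
    have : w = v := by
      by_contra hne
      exact hw' (Finset.mem_erase.2 ⟨hne, hw⟩)
    rw [this, hv0]
  rw [he, hull, Finset.coe_pair, convexHull_pair] at this
  exact this

/-- The boundary data determine the values on the whole boundary. -/
lemma HasOscillatoryData.eqOn_frontier {Tf : Mesh} {α : Finset Plane → ℝ} {K : Finset Plane}
    (hK : IsTriangle K) {p : Plane} (hp : p ∈ K) {u w : Plane → ℝ}
    (hu : HasOscillatoryData Tf α K p u) (hw : HasOscillatoryData Tf α K p w) :
    EqOn u w (frontier (hull K)) := by
  intro x hx
  obtain ⟨v, hv, q, hq, r, hr, hqr, hqv, hrv, hxs⟩ := exists_mem_segment_of_mem_frontier hK hx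
  by_cases h1 : q = p
  · subst h1
    rw [segment_symm] at hxs
    rw [hu.1 r hr hqr.symm x hxs, hw.1 r hr hqr.symm x hxs]
  by_cases h2 : r = p
  · subst h2
    rw [hu.1 q hq hqr x hxs, hw.1 q hq hqr x hxs]
  rw [hu.2 q hq h1 r hr h2 x hxs, hw.2 q hq h1 r hr h2 x hxs]

/-- Dirichlet's principle: u - φ vanishes on ∂K, hence is energy-orthogonal to φ, and 0 ≤ |u - φ|² =
|u|² - |φ|². -/
lemma IsMultiscaleBasis.energy_le {Tf : Mesh} {α : Finset Plane → ℝ} {K : Finset Plane}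
    (hα : ∀ τ ∈ elements Tf, 0 < α τ) (hK : IsRefined Tf K) {p : Plane} (hp : p ∈ K)
    {φ u : Plane → ℝ} (hφ : IsMultiscaleBasis Tf α K p φ) (hu : IsP1 Tf K u)
    (hb : HasOscillatoryData Tf α K p u) : energyForm Tf α K φ φ ≤ energyForm Tf α K u u := by
  have : Fintype (fineElements Tf K) := hK.finite.fintype
  have hw : IsP1Zero Tf K (u - φ) := ⟨hu.sub hφ.isP1, fun x hx => by
    simp [hb.eqOn_frontier hK.triangle hp hφ.boundary hx]⟩
  have h0 := hφ.harmonic _ hw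
  rw [hφ.isP1.energyForm_eq_inner hα hK hw.1, map_sub, inner_sub_right] at h0
  rw [hφ.isP1.energyForm_eq_inner hα hK hφ.isP1, hu.energyForm_eq_inner hα hK hu]
  have h1 := real_inner_self_nonneg (x := gradMap Tf α K u - gradMap Tf α K φ)
  rw [inner_sub_left, inner_sub_right, inner_sub_right,
    real_inner_comm (gradMap Tf α K φ) (gradMap Tf α K u)] at h1
  linarith

/-- Subtract from u a function w of S^h_0(K) whose scaled gradient is the orthogonal projection of
that of u onto the gradients of S^h_0(K). -/
lemma exists_isMultiscaleBasis {Tf : Mesh} {α : Finset Plane → ℝ} {K : Finset Plane}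
    (hα : ∀ τ ∈ elements Tf, 0 < α τ) (hK : IsRefined Tf K) {p : Plane}
    (hp : p ∈ K) {u : Plane → ℝ} (hu : IsP1 Tf K u)
    (hb : HasOscillatoryData Tf α K p u) : ∃ φ, IsMultiscaleBasis Tf α K p φ := by
  have : Fintype (fineElements Tf K) := hK.finite.fintype
  set S := (p1Zero Tf K).map (gradMap Tf α K) with hS
  obtain ⟨w, hw, hwS⟩ := Submodule.mem_map.1 (S.starProjection_apply_mem (gradMap Tf α K u))
  have hw' : IsP1Zero Tf K w := hw
  refine ⟨u - w, hu.sub hw'.1, ⟨fun q hq hqp x hx => ?_, fun q hq hqp r hr hrp x hx => ?_⟩,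
    fun v hv => ?_⟩
  · rw [Pi.sub_apply, hw'.2 x]
    · rw [sub_zero, hb.1 q hq hqp x hx]
    · exact mem_frontier_of_mem_segment hK.triangle hq hp hx
  · rw [Pi.sub_apply, hw'.2 x (mem_frontier_of_mem_segment hK.triangle hq hr hx), sub_zero,
      hb.2 q hq hqp r hr hrp x hx]
  · rw [(hu.sub hw'.1).energyForm_eq_inner hα hK hv.1, map_sub, hwS]
    exact S.starProjection_inner_eq_zero _ _ (Submodule.mem_map_of_mem hv)

/-! ### Lengths on the edges of a coarse element -/

lemma exists_third_vertex {K : Finset Plane} (h : IsTriangle K) (q r : Plane) :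
    ∃ v ∈ K, v ≠ q ∧ v ≠ r := by
  classical
  by_contra! hc
  have h1 : K ⊆ {q, r} := fun v hv => by
    by_cases hvq : v = q
    · simp [hvq]
    · simp [hc v hv hvq]
  have := (Finset.card_le_card h1).trans Finset.card_le_two
  rw [h.card] at this
  omega

lemma baryCoord_eq_zero_of_mem_segment {K : Finset Plane} (h : IsTriangle K) {q r v x : Plane}
    (hq : q ∈ K) (hr : r ∈ K) (hv : v ∈ K) (hvq : v ≠ q) (hvr : v ≠ r) (hx : x ∈ segment ℝ q r) :
    baryCoord K v x = 0 := by
  refine h.baryCoord_eq_zero_of_mem_hull (s := {q, r}) ?_ hv (by simp [hvq, hvr])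
    (by rwa [convexHull_pair])
  rintro w (rfl | rfl) <;> assumption

lemma baryCoord_ne_zero {K : Finset Plane} (h : IsTriangle K) {v : Plane} (hv : v ∈ K) :
    baryCoord K v ≠ 0 := fun h0 => by
  have := h.baryCoord_self hv
  rw [h0] at this
  simp at this

lemma baryCoord_vertex_nonneg {Tf : Mesh} {K τ : Finset Plane} (h : IsTriangle K)
    (hτ : τ ∈ fineElements Tf K) {v : Plane} (hv : v ∈ K) : ∀ w ∈ τ, 0 ≤ baryCoord K v w :=
  fun _ hw => h.mem_hull_iff.1 (hτ.2 (subset_convexHull ℝ _ hw)) v hv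

/-- All fine elements of K lie on the same side of each edge line, the zero set of the opposite
coordinate. Hence their traces on an edge overlap only in null sets, and `resistance` counts nothing
twice. -/
lemma segment_inter_subsingleton {Tf : Mesh} {K τ τ' : Finset Plane} (h : IsTriangle K)
    (hτ : τ ∈ fineElements Tf K) (hτ' : τ' ∈ fineElements Tf K) (hne : τ ≠ τ') {q r : Plane}
    (hq : q ∈ K) (hr : r ∈ K) : (segment ℝ q r ∩ (hull τ ∩ hull τ')).Subsingleton := by
  obtain ⟨v, hv, hvq, hvr⟩ := exists_third_vertex h q r
  rintro y ⟨hy, hyτ, hyτ'⟩ z ⟨hz, hzτ, hzτ'⟩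
  exact eq_of_mem_line hτ.1 hτ'.1 hne (baryCoord_ne_zero h hv) (baryCoord_vertex_nonneg h hτ hv)
    (baryCoord_vertex_nonneg h hτ' hv) hyτ hyτ' hzτ hzτ'
    (baryCoord_eq_zero_of_mem_segment h hq hr hv hvq hvr hy)
    (baryCoord_eq_zero_of_mem_segment h hq hr hv hvq hvr hz)

instance : NullSingletonClass (μH[1] : Measure Plane) :=
  Measure.nullSingletonClass_hausdorff Plane one_pos

lemma measurableSet_hull (τ : Finset Plane) : MeasurableSet (hull τ) :=
  (IsTriangle.isClosed_hull τ).measurableSet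

lemma measurableSet_segment (q r : Plane) : MeasurableSet (segment ℝ q r) := by
  rw [← convexHull_pair]
  exact ((toFinite {q, r}).isCompact_convexHull ℝ).isClosed.measurableSet

lemma hausdorffMeasure_ne_top_of_subset {A : Set Plane} {q r : Plane} (h : A ⊆ segment ℝ q r) :
    μH[1] A ≠ ⊤ :=
  ((measure_mono h).trans_lt (by rw [hausdorffMeasure_segment]; exact edist_lt_top q r)).ne

lemma resistance_eq_sum {Tf : Mesh} {K : Finset Plane} (hK : IsRefined Tf K)
    (α : Finset Plane → ℝ) (A : Set Plane) : resistance Tf α K A =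
      ∑ τ ∈ hK.finite.toFinset, (α τ)⁻¹ * (μH[1] (A ∩ hull τ)).toReal :=
  finsum_mem_eq_finite_toFinset_sum _ hK.finite

section Resistance

variable {Tf : Mesh} {α : Finset Plane → ℝ} {K : Finset Plane}

lemma resistance_nonneg (hα : ∀ τ ∈ elements Tf, 0 < α τ) (A : Set Plane) :
    0 ≤ resistance Tf α K A :=
  finsum_mem_induction (p := fun x : ℝ => 0 ≤ x) le_rfl (fun _ _ => add_nonneg)
    fun τ hτ => mul_nonneg (inv_nonneg.2 (hα τ hτ.1).le) ENNReal.toReal_nonneg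

lemma resistance_eq_zero (A : Set Plane) (hA : A.Subsingleton) :
    resistance Tf α K A = 0 := by
  refine (finsum_mem_congr rfl fun τ _ => ?_).trans (finsum_mem_zero _)
  rw [(hA.anti inter_subset_left).measure_zero, ENNReal.toReal_zero, mul_zero]

lemma resistance_union (hK : IsRefined Tf K) {A B : Set Plane} (hB : MeasurableSet B)
    (hA' : μH[1] A ≠ ⊤) (hB' : μH[1] B ≠ ⊤) (hAB : (A ∩ B).Subsingleton) :
    resistance Tf α K (A ∪ B) = resistance Tf α K A + resistance Tf α K B := by
  rw [resistance_eq_sum hK, resistance_eq_sum hK, resistance_eq_sum hK, ← Finset.sum_add_distrib]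
  refine Finset.sum_congr rfl fun τ _ => ?_
  rw [← mul_add, union_inter_distrib_right, measure_union₀
    (hB.inter (measurableSet_hull τ)).nullMeasurableSet, ENNReal.toReal_add]
  · exact ((measure_mono inter_subset_left).trans_lt hA'.lt_top).ne
  · exact ((measure_mono inter_subset_left).trans_lt hB'.lt_top).ne
  · exact (hAB.anti fun x hx => ⟨hx.1.1, hx.2.1⟩).measure_zero _

lemma sum_length_inter_le (hK : IsRefined Tf K) {q r : Plane} (hq : q ∈ K) (hr : r ∈ K)
    {A : Set Plane} (hA : A ⊆ segment ℝ q r) (hAm : MeasurableSet A) :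
    ∑ τ ∈ hK.finite.toFinset, (μH[1] (A ∩ hull τ)).toReal ≤ (μH[1] A).toReal := by
  rw [← ENNReal.toReal_sum fun τ _ =>
    hausdorffMeasure_ne_top_of_subset (inter_subset_left.trans hA), ← measure_biUnion_finset₀]
  · refine ENNReal.toReal_mono (hausdorffMeasure_ne_top_of_subset hA) (measure_mono ?_)
    exact iUnion₂_subset fun τ _ => inter_subset_left
  · intro τ hτ τ' hτ' hne
    refine ((segment_inter_subsingleton hK.triangle (by simpa using hτ) (by simpa using hτ') hne
      hq hr).anti ?_).measure_zero _
    exact fun x hx => ⟨hA hx.1.1, hx.1.2, hx.2.2⟩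
  · exact fun τ _ => (hAm.inter (measurableSet_hull τ)).nullMeasurableSet

/-- Inside one fine element, the resistance is the scaled length. -/
lemma resistance_of_subset_hull (hK : IsRefined Tf K) {q r : Plane} (hq : q ∈ K) (hr : r ∈ K)
    {A : Set Plane} (hA : A ⊆ segment ℝ q r) {τ : Finset Plane} (hτ : τ ∈ fineElements Tf K)
    (hAτ : A ⊆ hull τ) : resistance Tf α K A = (α τ)⁻¹ * (μH[1] A).toReal := by
  rw [resistance_eq_sum hK, Finset.sum_eq_single τ]
  · rw [inter_eq_left.2 hAτ]
  · intro τ' hτ' hne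
    rw [((segment_inter_subsingleton hK.triangle hτ (by simpa using hτ') hne.symm
      hq hr).anti fun x hx => ⟨hA hx.1, hAτ hx.1, hx.2⟩).measure_zero, ENNReal.toReal_zero, mul_zero]
  · intro h
    simp [hτ] at h

end Resistance

/-! ### Components of the high-conductivity region -/

section Components

variable {Tf : Mesh} {α : Finset Plane → ℝ} {K : Finset Plane} {ρ : ℝ}

lemma hull_subset_highRegion {τ : Finset Plane} (hτ : τ ∈ fineElements Tf K) (hρ : ρ < α τ) :
    hull τ ⊆ highRegion Tf α K ρ :=
  subset_biUnion_of_mem (u := fun τ => hull τ)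
    (show τ ∈ {τ | τ ∈ fineElements Tf K ∧ ρ < α τ} from ⟨hτ, hρ⟩)

lemma exists_of_mem_highRegion {x : Plane} (hx : x ∈ highRegion Tf α K ρ) :
    ∃ τ ∈ fineElements Tf K, ρ < α τ ∧ x ∈ hull τ := by
  obtain ⟨τ, hτ, hxτ⟩ := mem_iUnion₂.1 hx
  exact ⟨τ, hτ.1, hτ.2, hxτ⟩

lemma component_eq {C : Set Plane} (hC : C ∈ boundaryComponents Tf α K ρ) {x : Plane} (hx : x ∈ C) :
    C = connectedComponentIn (highRegion Tf α K ρ) x := by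
  obtain ⟨⟨y, hy, rfl⟩, -⟩ := hC
  exact connectedComponentIn_eq hx

lemma component_subset {C : Set Plane} (hC : C ∈ boundaryComponents Tf α K ρ) :
    C ⊆ highRegion Tf α K ρ := by
  obtain ⟨⟨y, hy, rfl⟩, -⟩ := hC
  exact connectedComponentIn_subset _ _

lemma hull_subset_component {C : Set Plane} (hC : C ∈ boundaryComponents Tf α K ρ)
    {τ : Finset Plane} (hτ : τ ∈ fineElements Tf K) (hρ : ρ < α τ) {x : Plane} (hx : x ∈ C)
    (hxτ : x ∈ hull τ) : hull τ ⊆ C := by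
  rw [component_eq hC hx]
  exact (convex_convexHull ℝ _).isPreconnected.subset_connectedComponentIn hxτ
    (hull_subset_highRegion hτ hρ)

lemma component_unique {C C' : Set Plane} (hC : C ∈ boundaryComponents Tf α K ρ)
    (hC' : C' ∈ boundaryComponents Tf α K ρ) {x : Plane} (hx : x ∈ C) (hx' : x ∈ C') : C = C' :=
  (component_eq hC hx).trans (component_eq hC' hx').symm

lemma exists_component_of_mem_frontier {x : Plane} (hx : x ∈ highRegion Tf α K ρ)
    (hxK : x ∈ frontier (hull K)) : ∃ C ∈ boundaryComponents Tf α K ρ, x ∈ C :=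
  ⟨_, ⟨⟨x, hx, rfl⟩, x, mem_connectedComponentIn hx, hxK⟩, mem_connectedComponentIn hx⟩

/-- Where the coefficient has the constant value `a`, it bounds the resistance. -/
lemma resistance_le_of_subset_component (hK : IsRefined Tf K) {q r : Plane} (hq : q ∈ K)
    (hr : r ∈ K) {C : Set Plane} (hC : C ∈ boundaryComponents Tf α K ρ) {a : ℝ} (ha : 0 < a)
    (hconst : ∀ τ ∈ fineElements Tf K, ρ < α τ → hull τ ⊆ C → α τ = a)
    {A : Set Plane} (hA : A ⊆ segment ℝ q r) (hAm : MeasurableSet A) (hAC : A ⊆ C) :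
    resistance Tf α K A ≤ a⁻¹ * (μH[1] A).toReal := by
  refine le_trans ?_ (mul_le_mul_of_nonneg_left (sum_length_inter_le hK hq hr hA hAm)
    (inv_nonneg.2 ha.le))
  rw [resistance_eq_sum hK, Finset.mul_sum]
  refine Finset.sum_le_sum fun τ hτ => ?_
  have hτ : τ ∈ fineElements Tf K := by simpa using hτ
  by_cases hρ : ρ < α τ
  · by_cases hne : (A ∩ hull τ).Nonempty
    · obtain ⟨x, hx, hxτ⟩ := hne
      rw [hconst τ hτ hρ (hull_subset_component hC hτ hρ (hAC hx) hxτ)]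
    · rw [not_nonempty_iff_eq_empty.1 hne]; simp
  -- A low element contributes nothing: every point of A lies in some high element, and each of
  -- these shares at most one point of the edge with τ.
  · have : (A ∩ hull τ).Finite := by
      have hfin : {τ' | τ' ∈ fineElements Tf K ∧ ρ < α τ'}.Finite :=
        hK.finite.subset fun τ' h => h.1
      refine (hfin.biUnion (t := fun τ' => segment ℝ q r ∩ (hull τ ∩ hull τ'))
        fun τ' hτ' => (segment_inter_subsingleton hK.triangle hτ hτ'.1 ?_ hq hr).finite).subset ?_
      · rintro rfl
        exact hρ hτ'.2
      · rintro x ⟨hx, hxτ⟩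
        obtain ⟨τ', hτ', hρ', hx'⟩ := exists_of_mem_highRegion (component_subset hC (hAC hx))
        exact mem_biUnion (x := τ') ⟨hτ', hρ'⟩ ⟨hA hx, hxτ, hx'⟩
    rw [this.measure_zero]
    simp

/-- The total resistance of an edge is bounded below. -/
lemma le_resistance_edge (hα : ∀ τ ∈ elements Tf, 0 < α τ) (hK : IsRefined Tf K) {c₀ c₁ : ℝ}
    (hρ : 1 ≤ ρ) (H : HighConductivityAssumption Tf α K ρ c₀ c₁) {q r : Plane}
    (hq : q ∈ K) (hr : r ∈ K) (hqr : q ≠ r) :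
    ρ⁻¹ * (c₀ * Metric.diam (hull K)) ≤ resistance Tf α K (segment ℝ q r) := by
  classical
  have h1 := H.uncovered q hq r hr hqr
  set L := hK.finite.toFinset.filter fun τ => α τ ≤ ρ with hL
  -- A high element through a point of ∂K belongs to a boundary component, so the uncovered part of
  -- the edge is covered by elements with α ≤ ρ.
  have h2 : segment ℝ q r \ (boundaryPart Tf α K ρ ∩ frontier (hull K)) ⊆
      ⋃ τ ∈ L, segment ℝ q r ∩ hull τ := by
    rintro x ⟨hx, hx'⟩
    have hxf := mem_frontier_of_mem_segment hK.triangle hq hr hx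
    obtain ⟨τ, hτ, hxτ⟩ := hK.exists_mem (hK.triangle.mem_frontier_hull_iff.1 hxf).1
    refine mem_biUnion (x := τ) ?_ ⟨hx, hxτ⟩
    rw [hL, Finset.coe_filter]
    refine ⟨by simpa using hτ, ?_⟩
    by_contra! hlt
    obtain ⟨C, hC, hxC⟩ := exists_component_of_mem_frontier (hull_subset_highRegion hτ hlt hxτ) hxf
    exact hx' ⟨⟨C, hC, hxC⟩, hxf⟩
  have h3 := h1.trans ((measure_mono h2).trans (measure_biUnion_finset_le _ _))
  have h4 : c₀ * Metric.diam (hull K) ≤ ∑ τ ∈ L, (μH[1] (segment ℝ q r ∩ hull τ)).toReal := by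
    have hfin : ∀ τ ∈ L, μH[1] (segment ℝ q r ∩ hull τ) ≠ ⊤ := fun τ _ =>
      hausdorffMeasure_ne_top_of_subset inter_subset_left
    rw [← ENNReal.toReal_sum hfin]
    exact (ENNReal.ofReal_le_iff_le_toReal (ENNReal.sum_ne_top.2 hfin)).1 h3
  have hρ0 : 0 < ρ := by linarith
  calc _ ≤ ρ⁻¹ * ∑ τ ∈ L, (μH[1] (segment ℝ q r ∩ hull τ)).toReal :=
        mul_le_mul_of_nonneg_left h4 (inv_nonneg.2 hρ0.le)
    _ ≤ ∑ τ ∈ L, (α τ)⁻¹ * (μH[1] (segment ℝ q r ∩ hull τ)).toReal := by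
        rw [Finset.mul_sum]
        refine Finset.sum_le_sum fun τ hτ => ?_
        rw [hL, Finset.mem_filter] at hτ
        have hτ' : τ ∈ fineElements Tf K := by simpa using hτ.1
        gcongr
        · exact hα τ hτ'.1
        · exact hτ.2
    _ ≤ _ := by
        rw [resistance_eq_sum hK]
        refine Finset.sum_le_sum_of_subset_of_nonneg (Finset.filter_subset _ _) fun τ hτ _ => ?_
        have hτ' : τ ∈ fineElements Tf K := by simpa using hτ
        have := hα τ hτ'.1
        positivity

end Components

/-! ### Parametrization of an edge -/

lemma segment_lineMap (q p : Plane) {a b : ℝ} (hab : a ≤ b) :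
    segment ℝ (AffineMap.lineMap q p a : Plane) (AffineMap.lineMap q p b) =
      AffineMap.lineMap q p '' Icc a b := by
  rw [← segment_eq_Icc hab, image_segment]

lemma eq_lineMap_baryCoord {K : Finset Plane} (h : IsTriangle K) {q p x : Plane} (hq : q ∈ K)
    (hp : p ∈ K) (hqp : q ≠ p) (hx : x ∈ segment ℝ q p) :
    x = AffineMap.lineMap q p (baryCoord K p x) ∧ 0 ≤ baryCoord K p x ∧ baryCoord K p x ≤ 1 := by
  rw [segment_eq_image_lineMap] at hx
  obtain ⟨t, ht, rfl⟩ := hx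
  have : baryCoord K p (AffineMap.lineMap q p t) = t := by
    rw [AffineMap.apply_lineMap, h.baryCoord_ne hp hq hqp.symm, h.baryCoord_self hp,
      AffineMap.lineMap_apply]
    simp
  rw [this]
  exact ⟨rfl, ht.1, ht.2⟩

section Edge

variable {Tf : Mesh} {α : Finset Plane → ℝ} {K : Finset Plane} {q p : Plane}

lemma lineMap_image_Icc_subset {a b : ℝ} (ha : 0 ≤ a) (hb : b ≤ 1) :
    AffineMap.lineMap q p '' Icc a b ⊆ segment ℝ q p := by
  rw [segment_eq_image_lineMap]
  exact image_mono (Icc_subset_Icc ha hb)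

lemma measurableSet_lineMap_image_Icc (a b : ℝ) :
    MeasurableSet (AffineMap.lineMap q p '' Icc a b : Set Plane) :=
  (isCompact_Icc.image AffineMap.lineMap_continuous).isClosed.measurableSet

lemma resistance_lineMap_add (hK : IsRefined Tf K) (hqp : q ≠ p) {a b c : ℝ} (ha : 0 ≤ a)
    (hab : a ≤ b) (hbc : b ≤ c) (hc : c ≤ 1) :
    resistance Tf α K (AffineMap.lineMap q p '' Icc a c) =
      resistance Tf α K (AffineMap.lineMap q p '' Icc a b) +
        resistance Tf α K (AffineMap.lineMap q p '' Icc b c) := by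
  rw [← Icc_union_Icc_eq_Icc hab hbc, image_union]
  refine resistance_union hK (measurableSet_lineMap_image_Icc b c)
    (hausdorffMeasure_ne_top_of_subset (lineMap_image_Icc_subset ha (hbc.trans hc)))
    (hausdorffMeasure_ne_top_of_subset (lineMap_image_Icc_subset (ha.trans hab) hc)) ?_
  rw [← image_inter (AffineMap.lineMap_injective ℝ hqp), Icc_inter_Icc_eq_singleton hab hbc]
  exact subsingleton_singleton.image _

/-- The difference of the integrals of `1 / α` from `q`. -/
lemma resistance_sub (hK : IsRefined Tf K) (hqp : q ≠ p) (hq : q ∈ K) (hp : p ∈ K) {x y : Plane}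
    (hx : x ∈ segment ℝ q p) (hy : y ∈ segment ℝ q p) (hxy : baryCoord K p x ≤ baryCoord K p y) :
    resistance Tf α K (segment ℝ q y) - resistance Tf α K (segment ℝ q x) =
      resistance Tf α K (segment ℝ x y) := by
  obtain ⟨ex, hx0, hx1⟩ := eq_lineMap_baryCoord hK.triangle hq hp hqp hx
  obtain ⟨ey, hy0, hy1⟩ := eq_lineMap_baryCoord hK.triangle hq hp hqp hy
  have e1 : segment ℝ q x = AffineMap.lineMap q p '' Icc 0 (baryCoord K p x) := by
    rw [← segment_lineMap _ _ hx0, ← ex, AffineMap.lineMap_apply_zero]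
  have e2 : segment ℝ q y = AffineMap.lineMap q p '' Icc 0 (baryCoord K p y) := by
    rw [← segment_lineMap _ _ hy0, ← ey, AffineMap.lineMap_apply_zero]
  have e3 : segment ℝ x y = AffineMap.lineMap q p '' Icc (baryCoord K p x) (baryCoord K p y) := by
    rw [← segment_lineMap _ _ hxy, ← ex, ← ey]
  rw [e1, e2, e3, resistance_lineMap_add hK hqp le_rfl hx0 hxy hy1]
  ring

lemma dist_edge (h : IsTriangle K) (hqp : q ≠ p) (hq : q ∈ K) (hp : p ∈ K) {x y : Plane}
    (hx : x ∈ segment ℝ q p) (hy : y ∈ segment ℝ q p) :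
    dist x y = |baryCoord K p x - baryCoord K p y| * dist q p := by
  obtain ⟨ex, -⟩ := eq_lineMap_baryCoord h hq hp hqp hx
  obtain ⟨ey, -⟩ := eq_lineMap_baryCoord h hq hp hqp hy
  conv_lhs => rw [ex, ey, dist_lineMap_lineMap]
  rfl

/-- On the part of an edge in one fine element, the boundary data are affine. -/
lemma resistance_affine (hK : IsRefined Tf K) (hqp : q ≠ p) (hq : q ∈ K)
    (hp : p ∈ K) {τ : Finset Plane} (hτ : τ ∈ fineElements Tf K) {x y : Plane}
    (hx : x ∈ segment ℝ q p) (hy : y ∈ segment ℝ q p) (hxτ : x ∈ hull τ) (hyτ : y ∈ hull τ) :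
    resistance Tf α K (segment ℝ q y) - resistance Tf α K (segment ℝ q x) =
      (α τ)⁻¹ * ((baryCoord K p y - baryCoord K p x) * dist q p) := by
  have key : ∀ x y : Plane, x ∈ segment ℝ q p → y ∈ segment ℝ q p → x ∈ hull τ → y ∈ hull τ →
      baryCoord K p x ≤ baryCoord K p y →
      resistance Tf α K (segment ℝ q y) - resistance Tf α K (segment ℝ q x) =
      (α τ)⁻¹ * ((baryCoord K p y - baryCoord K p x) * dist q p) := by
    intro x y hx hy hxτ hyτ hle
    rw [resistance_sub hK hqp hq hp hx hy hle,
      resistance_of_subset_hull hK hq hp ((convex_segment q p).segment_subset hx hy) hτ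
      ((convex_convexHull ℝ _).segment_subset hxτ hyτ), hausdorffMeasure_segment, edist_dist,
      ENNReal.toReal_ofReal dist_nonneg, dist_edge hK.triangle hqp hq hp hx hy, abs_sub_comm,
      abs_of_nonneg (sub_nonneg.2 hle)]
  rcases le_total (baryCoord K p x) (baryCoord K p y) with hle | hle
  · exact key x y hx hy hxτ hyτ hle
  · have := key y x hy hx hyτ hxτ hle
    linear_combination -this

end Edge

/-! ### The oscillatory boundary data -/

open Classical in
/-- The oscillatory boundary data of the vertex `p`, extended by zero. -/
def oscData (Tf : Mesh) (α : Finset Plane → ℝ) (K : Finset Plane) (p x : Plane) : ℝ :=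
  if h : ∃ q ∈ K, q ≠ p ∧ x ∈ segment ℝ q p then
    resistance Tf α K (segment ℝ h.choose x) / resistance Tf α K (segment ℝ h.choose p) else 0

section OscData

variable {Tf : Mesh} {α : Finset Plane → ℝ} {K : Finset Plane} {q p : Plane}

lemma eq_of_baryCoord_eq_zero (h : IsTriangle K) {x v : Plane} (hx : x ∈ hull K)
    (h0 : ∀ w ∈ K, w ≠ v → baryCoord K w x = 0) : x = v := by
  have := h.mem_hull_of_baryCoord_eq_zero (s := {v}) hx fun w hw hwv => h0 w hw (by simpa using hwv)
  simpa [hull] using this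

lemma mem_hull_of_mem_segment {r x : Plane} (hq : q ∈ K) (hr : r ∈ K) (hx : x ∈ segment ℝ q r) :
    x ∈ hull K :=
  (convex_convexHull ℝ _).segment_subset (subset_convexHull ℝ _ hq) (subset_convexHull ℝ _ hr) hx

/-- The choice of edge in the definition is harmless: two different edges at p share only p, where
both quotients equal 1. -/
lemma oscData_eq (h : IsTriangle K) (hR : ∀ q ∈ K, q ≠ p → 0 < resistance Tf α K (segment ℝ q p))
    (hp : p ∈ K) (hq : q ∈ K) (hqp : q ≠ p) {x : Plane} (hx : x ∈ segment ℝ q p) :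
    oscData Tf α K p x =
      resistance Tf α K (segment ℝ q x) / resistance Tf α K (segment ℝ q p) := by
  have hex : ∃ q ∈ K, q ≠ p ∧ x ∈ segment ℝ q p := ⟨q, hq, hqp, hx⟩
  rw [oscData, dif_pos hex]
  obtain ⟨h1, h2, h3⟩ := hex.choose_spec
  by_cases he : hex.choose = q
  · rw [he]
  · have : x = p := eq_of_baryCoord_eq_zero h (mem_hull_of_mem_segment hq hp hx) fun w hw hwp => by
      by_cases hwq : w = q
      · exact baryCoord_eq_zero_of_mem_segment h h1 hp hw (fun h' => he (h'.symm.trans hwq)) hwp h3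
      · exact baryCoord_eq_zero_of_mem_segment h hq hp hw hwq hwp hx
    generalize hex.choose = q' at h1 h2 h3
    rw [this, div_self (hR _ h1 h2).ne', div_self (hR _ hq hqp).ne']

/-- Either x is the initial vertex of an edge to p, where the integral runs over a single point, or
x lies on no such edge and the default value 0 applies. -/
lemma oscData_eq_zero (h : IsTriangle K) (hp : p ∈ K) {x : Plane} (hx : x ∈ hull K)
    (hx0 : baryCoord K p x = 0) : oscData Tf α K p x = 0 := by
  by_cases hex : ∃ q ∈ K, q ≠ p ∧ x ∈ segment ℝ q p
  · rw [oscData, dif_pos hex]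
    obtain ⟨h1, h2, h3⟩ := hex.choose_spec
    have : x = hex.choose := eq_of_baryCoord_eq_zero h hx fun w hw hwq => by
      by_cases hwp : w = p
      · rw [hwp, hx0]
      · exact baryCoord_eq_zero_of_mem_segment h h1 hp hw hwq hwp h3
    rw [resistance_eq_zero, zero_div]
    rw [← this, segment_same]
    exact subsingleton_singleton
  · rw [oscData, dif_neg hex]

lemma mem_segment_of_baryCoord_eq_zero (h : IsTriangle K) {r s x : Plane} (hx : x ∈ hull K)
    (hall : ∀ w ∈ K, w ≠ q → w ≠ r → w = s) (hs : baryCoord K s x = 0) : x ∈ segment ℝ q r := by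
  classical
  have := h.mem_hull_of_baryCoord_eq_zero (s := {q, r}) hx fun w hw hw' => by
    simp only [Finset.mem_insert, Finset.mem_singleton, not_or] at hw'
    rw [hall w hw hw'.1 hw'.2, hs]
  rwa [hull, Finset.coe_pair, convexHull_pair] at this

lemma eq_of_ne_of_ne (h : IsTriangle K) {r s w : Plane} (hq : q ∈ K) (hr : r ∈ K) (hs : s ∈ K)
    (hqr : q ≠ r) (hsq : s ≠ q) (hsr : s ≠ r) (hw : w ∈ K) (hwq : w ≠ q) (hwr : w ≠ r) :
    w = s := by
  classical
  by_contra hws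
  have : ({w, s, q, r} : Finset Plane) ⊆ K := by
    intro v hv
    simp only [Finset.mem_insert, Finset.mem_singleton] at hv
    rcases hv with rfl | rfl | rfl | rfl <;> assumption
  have := Finset.card_le_card this
  rw [h.card, Finset.card_insert_of_notMem (by simp [hws, hwq, hwr]),
    Finset.card_insert_of_notMem (by simp [hsq, hsr]), Finset.card_pair hqr] at this
  omega

/-- The nodal interpolant of the boundary data reproduces them on the whole boundary. -/
lemma hasOscillatoryData_nodalInterp (hK : IsRefined Tf K)
    (hR : ∀ q ∈ K, q ≠ p → 0 < resistance Tf α K (segment ℝ q p)) (hp : p ∈ K)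
    {f : Plane → ℝ} (hf : ∀ τ ∈ fineElements Tf K, ∀ v ∈ τ, v ∈ frontier (hull K) →
      f v = oscData Tf α K p v) : HasOscillatoryData Tf α K p (nodalInterp Tf K f) := by
  have h := hK.triangle
  constructor
  · intro q hq hqp x hx
    obtain ⟨s, hs, hsq, hsp⟩ := exists_third_vertex h q p
    have hall : ∀ w ∈ K, w ≠ q → w ≠ p → w = s := fun w hw h1 h2 =>
      eq_of_ne_of_ne h hq hp hs hqp hsq hsp hw h1 h2
    obtain ⟨τ, hτ, hxτ⟩ := hK.exists_mem (mem_hull_of_mem_segment hq hp hx)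
    have hτt := isTriangle_of_mem_elements hτ.1
    rw [nodalInterp_eqOn f hτ hxτ, interp_apply]
    set R := resistance Tf α K (segment ℝ q p) with hRdef
    set c := (α τ)⁻¹ * dist q p with hc
    have hz := hτt.mem_hull_of_affine_eq_zero (baryCoord_vertex_nonneg h hτ hs) hxτ
      (baryCoord_eq_zero_of_mem_segment h hq hp hs hsq hsp hx)
    -- On the part of the edge inside τ the data are affine in the coordinate of p, with slope c /
    -- R. Vertices of τ off the edge have weight 0 at x, so the sum may pretend that this affine
    -- formula holds at every vertex.
    have hterm : ∀ v ∈ τ, f v * baryCoord τ v x =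
        baryCoord τ v x * ((resistance Tf α K (segment ℝ q x) - c * baryCoord K p x) / R) +
          baryCoord τ v x * baryCoord K p v * (c / R) := by
      intro v hv
      by_cases hv0 : baryCoord K s v = 0
      · have hvK : v ∈ hull K := hτ.2 (subset_convexHull ℝ _ hv)
        have hvs : v ∈ segment ℝ q p := mem_segment_of_baryCoord_eq_zero h hvK hall hv0
        rw [hf τ hτ v hv (h.mem_frontier_hull_iff.2 ⟨hvK, s, hs, hv0⟩),
          oscData_eq h hR hp hq hqp hvs]
        have := resistance_affine (α := α) hK hqp hq hp hτ hx hvs hxτ (subset_convexHull ℝ _ hv)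
        have hR0 : R ≠ 0 := (hR q hq hqp).ne'
        rw [← hRdef]
        rw [sub_eq_iff_eq_add] at this
        rw [this, hc]
        field_simp
        ring
      · rw [hz v hv hv0]; ring
    rw [Finset.sum_congr rfl hterm, Finset.sum_add_distrib, ← Finset.sum_mul, ← Finset.sum_mul,
      hτt.sum_baryCoord, ← hτt.affine_apply]
    ring
  · intro q hq hqp r hr hrp x hx
    obtain ⟨τ, hτ, hxτ⟩ := hK.exists_mem (mem_hull_of_mem_segment hq hr hx)
    have hτt := isTriangle_of_mem_elements hτ.1
    rw [nodalInterp_eqOn f hτ hxτ, interp_apply]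
    refine Finset.sum_eq_zero fun v hv => ?_
    by_cases hv0 : baryCoord K p v = 0
    · have hvK : v ∈ hull K := hτ.2 (subset_convexHull ℝ _ hv)
      rw [hf τ hτ v hv (h.mem_frontier_hull_iff.2 ⟨hvK, p, hp, hv0⟩),
        oscData_eq_zero h hp hvK hv0, zero_mul]
    · rw [hτt.mem_hull_of_affine_eq_zero (baryCoord_vertex_nonneg h hτ hp) hxτ
        (baryCoord_eq_zero_of_mem_segment h hq hr hp hqp.symm hrp.symm hx) v hv hv0, mul_zero]

lemma oscData_mem_Icc (hα : ∀ τ ∈ elements Tf, 0 < α τ) (hK : IsRefined Tf K)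
    (hR : ∀ q ∈ K, q ≠ p → 0 < resistance Tf α K (segment ℝ q p)) (hp : p ∈ K) (x : Plane) :
    oscData Tf α K p x ∈ Icc (0 : ℝ) 1 := by
  by_cases hex : ∃ q ∈ K, q ≠ p ∧ x ∈ segment ℝ q p
  · obtain ⟨q, hq, hqp, hx⟩ := hex
    rw [oscData_eq hK.triangle hR hp hq hqp hx]
    refine ⟨div_nonneg (resistance_nonneg hα _) (resistance_nonneg hα _),
      (div_le_one (hR q hq hqp)).2 ?_⟩
    have := resistance_sub (α := α) hK hqp hq hp hx (right_mem_segment ℝ q p)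
      (by rw [hK.triangle.baryCoord_self hp]
          exact (eq_lineMap_baryCoord hK.triangle hq hp hqp hx).2.2)
    have := resistance_nonneg (K := K) hα (segment ℝ x p)
    linarith
  · rw [oscData, dif_neg hex]
    simp

end OscData

/-! ### Areas and packing -/

lemma area_le_of_subset_closedBall {A : Set Plane} {x : Plane} {R : ℝ} (hR : 0 ≤ R)
    (h : A ⊆ Metric.closedBall x R) : volume.real A ≤ R ^ 2 * Real.pi := by
  have h1 : volume A ≤ ENNReal.ofReal (R ^ 2 * Real.pi) := by
    refine (measure_mono h).trans ?_
    rw [EuclideanSpace.volume_closedBall_fin_two, ENNReal.ofReal_mul (by positivity),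
      ENNReal.ofReal_pow hR]
  exact ENNReal.toReal_le_of_le_ofReal (by positivity) h1

lemma le_area_of_closedBall_subset {τ : Finset Plane} {x : Plane} {r : ℝ} (hr : 0 ≤ r)
    (h : Metric.closedBall x r ⊆ hull τ) : r ^ 2 * Real.pi ≤ area τ := by
  have hsub : Metric.ball x r ⊆ interior (hull τ) :=
    interior_maximal (Metric.ball_subset_closedBall.trans h) Metric.isOpen_ball
  have h1 : ENNReal.ofReal (r ^ 2 * Real.pi) ≤ volume (interior (hull τ)) := by
    refine le_trans ?_ (measure_mono hsub)
    rw [EuclideanSpace.volume_ball_fin_two, ENNReal.ofReal_mul (by positivity),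
      ENNReal.ofReal_pow hr]
  exact (ENNReal.ofReal_le_iff_le_toReal
    ((measure_mono interior_subset).trans_lt (IsTriangle.isCompact_hull τ).measure_lt_top).ne).1 h1

lemma sum_area_le {T : Mesh} {S : Finset (Finset Plane)} (hS : ∀ τ ∈ S, τ ∈ elements T)
    {x : Plane} {R : ℝ} (hR : 0 ≤ R) (h : ∀ τ ∈ S, hull τ ⊆ Metric.closedBall x R) :
    ∑ τ ∈ S, area τ ≤ R ^ 2 * Real.pi := by
  have : ∑ τ ∈ S, area τ = volume.real (⋃ τ ∈ S, interior (hull τ)) := by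
    refine (measureReal_biUnion_finset (fun τ hτ τ' hτ' hne => ?_)
      (fun τ _ => isOpen_interior.measurableSet) fun τ _ => ?_).symm
    · exact (disjoint_interior_hull (hS τ hτ) (hS τ' hτ') hne).mono_right interior_subset
    · exact ((measure_mono interior_subset).trans_lt
        (IsTriangle.isCompact_hull τ).measure_lt_top).ne
  rw [this]
  exact area_le_of_subset_closedBall hR
    (iUnion₂_subset fun τ hτ => interior_subset.trans (h τ hτ))

lemma hull_subset_closedBall_diam {K : Finset Plane} {x : Plane} (hx : x ∈ hull K) :
    hull K ⊆ Metric.closedBall x (Metric.diam (hull K)) := fun _ hy =>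
  Metric.dist_le_diam_of_mem (IsTriangle.isCompact_hull K).isBounded hy hx

lemma IsTriangle.area_le {τ : Finset Plane} (h : IsTriangle τ) :
    area τ ≤ Metric.diam (hull τ) ^ 2 * Real.pi := by
  obtain ⟨v, hv⟩ := h.nonempty
  exact area_le_of_subset_closedBall Metric.diam_nonneg
    (interior_subset.trans (hull_subset_closedBall_diam (subset_convexHull ℝ _ hv)))

lemma IsRefined.sum_area_le {Tf : Mesh} {K : Finset Plane} (hK : IsRefined Tf K) :
    ∑ τ ∈ hK.finite.toFinset, area τ ≤ Metric.diam (hull K) ^ 2 * Real.pi := by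
  obtain ⟨v, hv⟩ := hK.triangle.nonempty
  refine MSFEM.sum_area_le (T := Tf) (x := v) (fun τ hτ => ?_) Metric.diam_nonneg fun τ hτ => ?_
  · exact (by simpa using hτ : τ ∈ fineElements Tf K).1
  · exact (by simpa using hτ : τ ∈ fineElements Tf K).2.trans
      (hull_subset_closedBall_diam (subset_convexHull ℝ _ hv))

lemma diam_le_meshSize {T : Mesh} (hT : (elements T).Finite) {τ : Finset Plane}
    (hτ : τ ∈ elements T) : Metric.diam (hull τ) ≤ meshSize T :=
  le_csSup (hT.image _).bddAbove (mem_image_of_mem _ hτ)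

/-- Packing: elements have diameter at least h/σ and so contain discs of radius h/σ², while their
disjoint interiors fit into a disc of radius R. -/
lemma card_mul_le {T : Mesh} {σ : ℝ} (hσ : 0 < σ) (hT : QuasiUniform T σ) (hh : 0 < meshSize T)
    {S : Finset (Finset Plane)} (hS : ∀ τ ∈ S, τ ∈ elements T) {x : Plane} {R : ℝ} (hR : 0 ≤ R)
    (h : ∀ τ ∈ S, hull τ ⊆ Metric.closedBall x R) :
    (S.card : ℝ) ≤ (R * σ ^ 2 / meshSize T) ^ 2 := by
  have h1 : ∀ τ ∈ S, (meshSize T / σ ^ 2) ^ 2 * Real.pi ≤ area τ := fun τ hτ => by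
    obtain ⟨y, hy⟩ := hT.1 τ (hS τ hτ)
    have h2 := hT.2 τ (hS τ hτ)
    refine le_area_of_closedBall_subset (by positivity)
      ((Metric.closedBall_subset_closedBall ?_).trans hy)
    rw [div_le_div_iff₀ (by positivity) hσ]
    nlinarith
  have h2 := (Finset.card_nsmul_le_sum S _ _ h1).trans (sum_area_le hS hR h)
  rw [nsmul_eq_mul, ← mul_assoc] at h2
  have h3 := le_of_mul_le_mul_right h2 Real.pi_pos
  rw [div_pow, le_div_iff₀ (by positivity)]
  rw [div_pow, mul_div_assoc', div_le_iff₀ (by positivity)] at h3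
  calc _ ≤ _ := h3
    _ = _ := by ring

/-! ### Counting elements near a set of finite length -/

/-- The distance to v is 1-Lipschitz, so it does not increase length, and its image contains (0, r).
-/
lemma ofReal_le_hausdorffMeasure {F : Set Plane} {v : Plane} {r : ℝ}
    (h : ∀ s ∈ Ioo 0 r, ∃ x ∈ F, dist x v = s) :
    ENNReal.ofReal r ≤ μH[1] (F ∩ Metric.closedBall v r) := by
  have hsub : Ioo 0 r ⊆ (fun x => dist x v) '' (F ∩ Metric.closedBall v r) := fun s hs => by
    obtain ⟨x, hx, hxs⟩ := h s hs
    exact ⟨x, ⟨hx, by rw [Metric.mem_closedBall, hxs]; exact hs.2.le⟩, hxs⟩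
  calc ENNReal.ofReal r = μH[1] (Ioo 0 r) := by
        rw [hausdorffMeasure_real, Real.volume_Ioo, sub_zero]
    _ ≤ μH[1] ((fun x => dist x v) '' (F ∩ Metric.closedBall v r)) := measure_mono hsub
    _ ≤ μH[1] (F ∩ Metric.closedBall v r) := by
        simpa using (LipschitzWith.dist_left v).hausdorffMeasure_image_le zero_le_one
          (F ∩ Metric.closedBall v r)

/-- The constant of `card_mul_meshSize_le`. -/
def countConst (σ : ℝ) : ℝ := 2 * σ ^ 2 * (1 / 2 + σ ^ 2) ^ 2

/-- Double counting: each element has a ball of radius r ~ h containing length at least r of F, and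
these balls overlap boundedly. Applied with F = ∂K and with F the boundary of K^B(ρ). -/
lemma card_mul_meshSize_le {T : Mesh} {σ : ℝ} (hσ : 0 < σ) (hT : QuasiUniform T σ)
    (hfin : (elements T).Finite) (hh : 0 < meshSize T) {S : Finset (Finset Plane)}
    (hS : ∀ τ ∈ S, τ ∈ elements T) {F : Set Plane} {L : ℝ} (hL : 0 ≤ L)
    (hFL : μH[1] F ≤ ENNReal.ofReal L)
    (h : ∀ τ ∈ S, ∃ v ∈ hull τ, ∀ s ∈ Ioo 0 (meshSize T / (2 * σ ^ 2)), ∃ x ∈ F, dist x v = s) :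
    (S.card : ℝ) * meshSize T ≤ countConst σ * L := by
  classical
  set r := meshSize T / (2 * σ ^ 2) with hr
  have hr0 : 0 < r := by positivity
  choose! v hv hvF using h
  set M : ℝ := (1 / 2 + σ ^ 2) ^ 2 with hM
  have hM0 : 0 ≤ M := by positivity
  have hover : ∀ x, ∑ τ ∈ S, (Metric.closedBall (v τ) r).indicator (1 : Plane → ENNReal) x ≤
      ENNReal.ofReal M := by
    intro x
    have h1 : ∑ τ ∈ S, (Metric.closedBall (v τ) r).indicator (1 : Plane → ENNReal) x =
        ((S.filter fun τ => x ∈ Metric.closedBall (v τ) r).card : ENNReal) := by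
      simp only [indicator_apply, Pi.one_apply]
      rw [← Finset.sum_filter, Finset.sum_const, nsmul_eq_mul, mul_one]
    rw [h1, ← ENNReal.ofReal_natCast]
    refine ENNReal.ofReal_le_ofReal ?_
    have h2 := card_mul_le hσ hT hh (S := S.filter fun τ => x ∈ Metric.closedBall (v τ) r)
      (x := x) (R := r + meshSize T) (fun τ hτ => hS τ (Finset.mem_filter.1 hτ).1) (by positivity)
      fun τ hτ y hy => by
        obtain ⟨hτS, hx⟩ := Finset.mem_filter.1 hτ
        rw [Metric.mem_closedBall, dist_comm] at hx
        have h3 : dist y (v τ) ≤ meshSize T := (hull_subset_closedBall_diam (hv τ hτS) hy).trans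
          (diam_le_meshSize hfin (hS τ hτS))
        rw [Metric.mem_closedBall]
        linarith [dist_triangle y (v τ) x]
    -- Elements whose ball contains x lie within r + h of x, which gives the overlap bound M.
    have h3 : (r + meshSize T) * σ ^ 2 / meshSize T = 1 / 2 + σ ^ 2 := by
      rw [hr]; field_simp
    rwa [h3] at h2
  have hsum : (S.card : ENNReal) * ENNReal.ofReal r ≤ ENNReal.ofReal M * ENNReal.ofReal L :=
    calc (S.card : ENNReal) * ENNReal.ofReal r
        = ∑ τ ∈ S, ENNReal.ofReal r := by rw [Finset.sum_const, nsmul_eq_mul]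
      _ ≤ ∑ τ ∈ S, μH[1].restrict F (Metric.closedBall (v τ) r) := by
          refine Finset.sum_le_sum fun τ hτ => ?_
          rw [Measure.restrict_apply Metric.isClosed_closedBall.measurableSet, inter_comm]
          exact ofReal_le_hausdorffMeasure (hvF τ hτ)
      _ = ∫⁻ x in F, ∑ τ ∈ S, (Metric.closedBall (v τ) r).indicator 1 x ∂μH[1] := by
          rw [lintegral_finsetSum]
          · refine Finset.sum_congr rfl fun τ _ => ?_
            rw [lintegral_indicator_one Metric.isClosed_closedBall.measurableSet]
          · exact fun τ _ => measurable_one.indicator Metric.isClosed_closedBall.measurableSet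
      _ ≤ ∫⁻ x in F, ENNReal.ofReal M ∂μH[1] := lintegral_mono hover
      _ = ENNReal.ofReal M * μH[1] F := by rw [setLIntegral_const]
      _ ≤ _ := by gcongr
  rw [← ENNReal.ofReal_natCast, ← ENNReal.ofReal_mul (by positivity), ← ENNReal.ofReal_mul hM0,
    ENNReal.ofReal_le_ofReal_iff (by positivity), hr] at hsum
  rw [mul_div_assoc', div_le_iff₀ (by positivity)] at hsum
  calc _ ≤ _ := hsum
    _ = countConst σ * L := by rw [countConst, hM]; ring

/-! ### Points at prescribed distance -/

lemma exists_dist_eq {F : Set Plane} (hF : IsPreconnected F) {v w : Plane} (hv : v ∈ F)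
    (hw : w ∈ F) {s : ℝ} (hs : 0 ≤ s) (hsw : s ≤ dist w v) : ∃ x ∈ F, dist x v = s := by
  have := hF.intermediate_value hv hw (f := fun x => dist x v)
    (continuous_id.dist continuous_const).continuousOn
  exact this ⟨by simpa using hs, hsw⟩

/-- Two antipodal points of the disc are 2R apart, so they cannot both be closer than R to v. -/
lemma exists_dist_ge {A : Set Plane} {c : Plane} {R : ℝ} (hR : 0 ≤ R)
    (h : Metric.closedBall c R ⊆ A) (v : Plane) : ∃ w ∈ A, R ≤ dist w v := by
  obtain ⟨e, he⟩ := exists_norm_eq Plane hR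
  have h1 : c + e ∈ A := h (by simp [he])
  have h2 : c - e ∈ A := h (by simp [he])
  have h3 : dist (c + e) (c - e) = 2 * R := by
    rw [dist_eq_norm, show c + e - (c - e) = (2 : ℝ) • e by rw [two_smul]; abel, norm_smul, he]
    simp
  by_contra! hc
  have := hc _ h1
  have := hc _ h2
  linarith [dist_triangle_right (c + e) (c - e) v]

lemma exists_mem_hull_dist_eq {T : Mesh} {σ : ℝ} (hσ : 0 < σ) (hT : QuasiUniform T σ)
    {τ : Finset Plane} (hτ : τ ∈ elements T) {v : Plane}
    (hv : v ∈ hull τ) {s : ℝ} (hs : s ∈ Ioo 0 (meshSize T / (2 * σ ^ 2))) :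
    ∃ x ∈ hull τ, dist x v = s := by
  obtain ⟨c, hc⟩ := hT.1 τ hτ
  obtain ⟨w, hw, hwv⟩ := exists_dist_ge (by have := Metric.diam_nonneg (s := hull τ); positivity) hc v
  refine exists_dist_eq (convex_convexHull ℝ _).isPreconnected hv hw hs.1.le
    (le_trans ?_ hwv)
  have h2 := hT.2 τ hτ
  have h3 := hs.2
  rw [lt_div_iff₀ (by positivity)] at h3
  rw [le_div_iff₀ hσ]
  have h4 := hs.1
  have h5 : 2 * (s * σ) ≤ Metric.diam (hull τ) := by
    refine le_of_mul_le_mul_left (a := σ) ?_ hσ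
    linarith
  nlinarith

/-- Near a common point of an element in `B` and an element outside `B`, the frontier of `B`
meets all small circles. -/
lemma exists_mem_frontier_dist_eq {T : Mesh} {σ : ℝ} (hσ : 0 < σ) (hT : QuasiUniform T σ)
    {B : Set Plane} {τ τ' : Finset Plane} (hτ : τ ∈ elements T) (hτ' : τ' ∈ elements T)
    (hτB : hull τ ⊆ B) (hτB' : Disjoint (interior (hull τ')) B) {v : Plane} (hv : v ∈ hull τ)
    (hv' : v ∈ hull τ') {s : ℝ} (hs : s ∈ Ioo 0 (meshSize T / (2 * σ ^ 2))) :
    ∃ x ∈ frontier B, dist x v = s := by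
  obtain ⟨x, hx, hxs⟩ := exists_mem_hull_dist_eq hσ hT hτ hv hs
  obtain ⟨y, hy, hys⟩ := exists_mem_hull_dist_eq hσ hT hτ' hv' hs
  have hy' : y ∈ closure Bᶜ := by
    rw [← (isTriangle_of_mem_elements hτ').closure_interior_hull] at hy
    exact closure_mono hτB'.subset_compl_right hy
  -- In the plane a circle is connected. It meets the closures of B and of its complement, hence
  -- their intersection, the frontier.
  have hcon : IsPreconnected (Metric.sphere v s) :=
    isPreconnected_sphere (by
      rw [← Module.finrank_eq_rank, finrank_euclideanSpace_fin]
      norm_num) v s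
  obtain ⟨z, hz, hzB⟩ := isPreconnected_closed_iff.1 hcon (closure B) (closure Bᶜ) isClosed_closure
    isClosed_closure (fun z _ => by
      by_cases hzB : z ∈ B
      · exact Or.inl (subset_closure hzB)
      · exact Or.inr (subset_closure hzB)) ⟨x, hxs, subset_closure (hτB hx)⟩ ⟨y, hys, hy'⟩
  exact ⟨z, by rwa [frontier_eq_closure_inter_closure], hz⟩

/-- The coordinate of q changes by 1 along the edge, with slope at most σ / diam. -/
lemma diam_le_mul_dist {K : Finset Plane} (h : IsTriangle K) {σ : ℝ} (hσ : 0 < σ)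
    (hreg : ∃ x, Metric.closedBall x (Metric.diam (hull K) / σ) ⊆ hull K) {q r : Plane}
    (hq : q ∈ K) (hr : r ∈ K) (hqr : q ≠ r) : Metric.diam (hull K) ≤ σ * dist q r := by
  have h1 := abs_affine_sub_le (baryCoord K q) q r
  rw [h.baryCoord_self hq, h.baryCoord_ne hq hr hqr, sub_zero, abs_one] at h1
  have h2 := h1.trans (mul_le_mul_of_nonneg_right (h.norm_affGrad_baryCoord_le hσ hreg hq)
    dist_nonneg)
  have := h.diam_pos
  rw [div_mul_eq_mul_div, le_div_iff₀ this] at h2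
  linarith

/-- One endpoint is at least half the length away from v. This is the source of the factor 2 in the
radius h / (2σ²). -/
lemma exists_mem_segment_dist_eq {q r v : Plane} (hv : v ∈ segment ℝ q r) {s : ℝ} (hs : 0 ≤ s)
    (hsr : 2 * s ≤ dist q r) : ∃ x ∈ segment ℝ q r, dist x v = s := by
  have hcon := (convex_segment (𝕜 := ℝ) q r).isPreconnected
  by_cases h : s ≤ dist q v
  · exact exists_dist_eq hcon hv (left_mem_segment ℝ q r) hs h
  · refine exists_dist_eq hcon hv (right_mem_segment ℝ q r) hs ?_
    linarith [dist_triangle_right q r v]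

/-! ### Contact sets of the boundary components -/

lemma IsTriangle.sum_three {K : Finset Plane} (h : IsTriangle K) {q p s : Plane} (hq : q ∈ K)
    (hp : p ∈ K) (hs : s ∈ K) (hqp : q ≠ p) (hsq : s ≠ q) (hsp : s ≠ p) (x : Plane) :
    baryCoord K q x + baryCoord K p x + baryCoord K s x = 1 := by
  classical
  have hK : K = {q, p, s} := by
    ext w
    simp only [Finset.mem_insert, Finset.mem_singleton]
    constructor
    · intro hw
      by_cases h1 : w = q
      · exact Or.inl h1
      by_cases h2 : w = p
      · exact Or.inr (Or.inl h2)
      exact Or.inr (Or.inr (eq_of_ne_of_ne h hq hp hs hqp hsq hsp hw h1 h2))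
    · rintro (rfl | rfl | rfl) <;> assumption
  have h1 := h.sum_baryCoord x
  have h2 : ∑ v ∈ K, baryCoord K v x = ∑ v ∈ ({q, p, s} : Finset Plane), baryCoord K v x :=
    congrArg (fun S : Finset Plane => ∑ v ∈ S, baryCoord K v x) hK
  rw [h2, Finset.sum_insert (by simp [hqp, hsq.symm]), Finset.sum_pair hsp.symm] at h1
  linarith

lemma IsTriangle.ext_three {K : Finset Plane} (h : IsTriangle K) {q p s : Plane} (hq : q ∈ K)
    (hp : p ∈ K) (hs : s ∈ K) (hqp : q ≠ p) (hsq : s ≠ q) (hsp : s ≠ p) {x y : Plane}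
    (h1 : baryCoord K q x = baryCoord K q y) (h2 : baryCoord K p x = baryCoord K p y) : x = y := by
  refine h.ext_baryCoord fun w hw => ?_
  have h3 := h.sum_three hq hp hs hqp hsq hsp x
  have h4 := h.sum_three hq hp hs hqp hsq hsp y
  by_cases h5 : w = q
  · rwa [h5]
  by_cases h6 : w = p
  · rwa [h6]
  rw [eq_of_ne_of_ne h hq hp hs hqp hsq hsp hw h5 h6]
  linarith

lemma exists_affine_eq_zero {Γ : Set Plane} (hΓ : IsPreconnected Γ) (g : Plane →ᵃ[ℝ] ℝ)
    {x y : Plane} (hx : x ∈ Γ) (hy : y ∈ Γ) (gx : 0 ≤ g x) (gy : g y ≤ 0) : ∃ w ∈ Γ, g w = 0 :=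
  hΓ.intermediate_value hy hx g.continuous_of_finiteDimensional.continuousOn ⟨gy, gx⟩

section Contact

variable {Tf : Mesh} {α : Finset Plane → ℝ} {K : Finset Plane} {ρ c₀ c₁ : ℝ}

/-- Otherwise the uncovered part of the edge would consist of its endpoints at most and have length
0. -/
lemma exists_uncovered (h : IsTriangle K) (hc₀ : 0 < c₀)
    (H : HighConductivityAssumption Tf α K ρ c₀ c₁) {q r : Plane} (hq : q ∈ K) (hr : r ∈ K)
    (hqr : q ≠ r) {C : Set Plane} (hC : C ∈ boundaryComponents Tf α K ρ) :
    ∃ z ∈ segment ℝ q r, z ≠ q ∧ z ≠ r ∧ z ∉ C := by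
  by_contra! hc
  have h1 := H.uncovered q hq r hr hqr
  have h2 : segment ℝ q r \ (boundaryPart Tf α K ρ ∩ frontier (hull K)) ⊆ {q, r} := by
    rintro z ⟨hz, hz'⟩
    by_contra hne
    simp only [mem_insert_iff, mem_singleton_iff, not_or] at hne
    exact hz' ⟨⟨C, hC, hc z hz hne.1 hne.2⟩, mem_frontier_of_mem_segment h hq hr hz⟩
  have h3 := h1.trans (measure_mono h2)
  rw [(toFinite {q, r}).measure_zero, nonpos_iff_eq_zero, ENNReal.ofReal_eq_zero] at h3
  have := mul_pos hc₀ h.diam_pos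
  linarith

/-- A contact set contains the part of an edge between any two of its points. -/
lemma segment_subset_component (h : IsTriangle K) (hc₀ : 0 < c₀)
    (H : HighConductivityAssumption Tf α K ρ c₀ c₁) {q p : Plane} (hq : q ∈ K) (hp : p ∈ K)
    (hqp : q ≠ p) {C : Set Plane} (hC : C ∈ boundaryComponents Tf α K ρ) {x y : Plane}
    (hx : x ∈ segment ℝ q p) (hy : y ∈ segment ℝ q p) (hxC : x ∈ C) (hyC : y ∈ C) :
    segment ℝ x y ⊆ C := by
  wlog hxy : baryCoord K p x ≤ baryCoord K p y generalizing x y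
  · rw [segment_symm]
    exact this hy hx hyC hxC (le_of_not_ge hxy)
  intro z hz
  by_contra hzC
  have hzE : z ∈ segment ℝ q p := (convex_segment q p).segment_subset hx hy hz
  obtain ⟨s, hs, hsq, hsp⟩ := exists_third_vertex h q p
  -- The line through the gap z and a gap z' on the edge [q, s] separates x from y and meets ∂K only
  -- at z and z'. The affine function used below vanishes exactly on this line, so a connected
  -- contact set would have to pass through a gap.
  obtain ⟨z', hz', hzq', hzs', hzC'⟩ := exists_uncovered h hc₀ H hq hs hsq.symm hC
  have zero_s := fun {w} hw => baryCoord_eq_zero_of_mem_segment h hq hp hs hsq hsp (x := w) hw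
  have zero_p := baryCoord_eq_zero_of_mem_segment h hq hs hp hqp.symm hsp.symm hz'
  have sum := h.sum_three hq hp hs hqp hsq hsp
  have ext {w w' : Plane} := h.ext_three hq hp hs hqp hsq hsp (x := w) (y := w')
  set t := baryCoord K p z with ht
  set u := baryCoord K s z' with hu
  have hzlin : baryCoord K p x ≤ t ∧ t ≤ baryCoord K p y := by
    rw [segment_eq_image_lineMap] at hz
    obtain ⟨θ, hθ, rfl⟩ := hz
    rw [ht, AffineMap.apply_lineMap, AffineMap.lineMap_apply_module']
    simp only [smul_eq_mul]
    constructor <;> nlinarith [hθ.1, hθ.2]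
  have heq : ∀ w ∈ segment ℝ q p, baryCoord K p w = t → w = z := fun w hw he => by
    refine ext ?_ he
    have h1 := sum w
    have h2 := sum z
    rw [zero_s hw] at h1
    rw [zero_s hzE] at h2
    linarith
  have hxt : baryCoord K p x < t := lt_of_le_of_ne hzlin.1 fun he => hzC (heq x hx he ▸ hxC)
  have hyt : t < baryCoord K p y := lt_of_le_of_ne hzlin.2 fun he => hzC (heq y hy he.symm ▸ hyC)
  have hx0 := (eq_lineMap_baryCoord h hq hp hqp hx).2.1
  have hy1 := (eq_lineMap_baryCoord h hq hp hqp hy).2.2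
  have hzK' := h.mem_hull_iff.1 (mem_hull_of_mem_segment hq hs hz')
  have hu0 : 0 < u := lt_of_le_of_ne (hzK' s hs) fun he => hzq' (ext (by
    have h1 := sum z'
    rw [h.baryCoord_self hq]
    linarith) (by rw [zero_p, h.baryCoord_ne hp hq hqp.symm]))
  have hu1 : u < 1 := by
    have h1 := sum z'
    refine lt_of_le_of_ne (by linarith [hzK' q hq]) fun he => hzs' (ext ?_ ?_)
    · rw [h.baryCoord_ne hq hs hsq.symm]
      linarith
    · rw [zero_p, h.baryCoord_ne hp hs hsp.symm]
  have hg (w : Plane) : ((t * u) • baryCoord K q - ((1 - t) * u) • baryCoord K p -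
      ((1 - u) * t) • baryCoord K s) w = t * u * baryCoord K q w - (1 - t) * u * baryCoord K p w -
      (1 - u) * t * baryCoord K s w := rfl
  have h1 := sum x
  have h2 := sum y
  rw [zero_s hx] at h1
  rw [zero_s hy] at h2
  obtain ⟨w, hw, gw⟩ := exists_affine_eq_zero (H.contact C hC).isPreconnected
    ((t * u) • baryCoord K q - ((1 - t) * u) • baryCoord K p - ((1 - u) * t) • baryCoord K s)
    (x := x) (y := y) ⟨hxC, mem_frontier_of_mem_segment h hq hp hx⟩
    ⟨hyC, mem_frontier_of_mem_segment h hq hp hy⟩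
    (by rw [hg, zero_s hx, show baryCoord K q x = 1 - baryCoord K p x by linarith]
        nlinarith [mul_pos hu0 (sub_pos.2 hxt)])
    (by rw [hg, zero_s hy, show baryCoord K q y = 1 - baryCoord K p y by linarith]
        nlinarith [mul_pos hu0 (sub_pos.2 hyt)])
  rw [hg] at gw
  obtain ⟨hwK, v, hv, hv0⟩ := h.mem_frontier_hull_iff.1 hw.2
  have hwK' := h.mem_hull_iff.1 hwK
  have h3 := sum w
  -- A zero on the edge opposite q is impossible; on the edge opposite p it is z', and on the edge
  -- opposite s it is z.
  by_cases e1 : v = q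
  · subst e1
    have a1 : 0 ≤ (1 - t) * u * baryCoord K p w :=
      mul_nonneg (mul_nonneg (by linarith) hu0.le) (hwK' p hp)
    have a2 : 0 ≤ (1 - u) * t * baryCoord K s w :=
      mul_nonneg (mul_nonneg (by linarith) (by linarith)) (hwK' s hs)
    rw [hv0, mul_zero] at gw
    have a3 : (1 - t) * u * baryCoord K p w = 0 := by linarith
    have a4 : (1 - u) * t * baryCoord K s w = 0 := by linarith
    have a5 := (mul_eq_zero.1 a3).resolve_left (mul_pos (by linarith) hu0).ne'
    have a6 := (mul_eq_zero.1 a4).resolve_left (mul_pos (by linarith) (by linarith)).ne'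
    linarith
  by_cases e2 : v = p
  · subst e2
    have a1 : t * (u - baryCoord K s w) = 0 := by
      rw [hv0] at gw h3
      linear_combination gw - t * u * h3
    have a2 := (mul_eq_zero.1 a1).resolve_left (by linarith)
    have : w = z' := ext (by have := sum z'; linarith) (by rw [hv0, zero_p])
    exact hzC' (this ▸ hw.1)
  have e3 := eq_of_ne_of_ne h hq hp hs hqp hsq hsp hv e1 e2
  subst e3
  have a1 : u * (t - baryCoord K p w) = 0 := by
    rw [hv0] at gw h3
    linear_combination gw - t * u * h3
  have a2 := (mul_eq_zero.1 a1).resolve_left hu0.ne'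
  have : w = z := ext (by have := sum z; rw [zero_s hzE] at this; linarith) (by linarith)
  exact hzC (this ▸ hw.1)

/-- A contact set that meets two edges contains their common vertex. -/
lemma vertex_mem_component (h : IsTriangle K) (hc₀ : 0 < c₀)
    (H : HighConductivityAssumption Tf α K ρ c₀ c₁) {s m n : Plane} (hs : s ∈ K) (hm : m ∈ K)
    (hn : n ∈ K) (hsm : s ≠ m) (hsn : s ≠ n) (hmn : m ≠ n) {C : Set Plane}
    (hC : C ∈ boundaryComponents Tf α K ρ) {x y : Plane}
    (hx : x ∈ segment ℝ s m) (hy : y ∈ segment ℝ s n) (hxC : x ∈ C) (hyC : y ∈ C) : s ∈ C := by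
  by_contra hsC
  -- The separating line now runs through s and a gap z of the opposite edge; x and y lie on its two
  -- closed sides, so the contact set would contain s or z.
  obtain ⟨z, hz, hzm, hzn, hzC⟩ := exists_uncovered h hc₀ H hm hn hmn hC
  have sum := h.sum_three hm hn hs hmn hsm hsn
  have ext {w w' : Plane} := h.ext_three hm hn hs hmn hsm hsn (x := w) (y := w')
  have z0 := baryCoord_eq_zero_of_mem_segment h hm hn hs hsm hsn hz
  have x0 := baryCoord_eq_zero_of_mem_segment h hs hm hn hsn.symm hmn.symm hx
  have y0 := baryCoord_eq_zero_of_mem_segment h hs hn hm hsm.symm hmn hy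
  have hzK := h.mem_hull_iff.1 (mem_hull_of_mem_segment hm hn hz)
  set u := baryCoord K n z with hu
  have hmz : baryCoord K m z = 1 - u := by have := sum z; linarith
  have hu0 : 0 < u := lt_of_le_of_ne (hzK n hn) fun he => hzm (ext
    (by rw [h.baryCoord_self hm, hmz]; linarith) (by rw [h.baryCoord_ne hn hm hmn.symm, he]))
  have hu1 : u < 1 := lt_of_le_of_ne (by have := hzK m hm; linarith) fun he => hzn (ext
    (by rw [h.baryCoord_ne hm hn hmn, hmz]; linarith) (by rw [h.baryCoord_self hn, ← hu, he]))
  have hg (w : Plane) : (u • baryCoord K m - (1 - u) • baryCoord K n) w =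
      u * baryCoord K m w - (1 - u) * baryCoord K n w := rfl
  obtain ⟨w, hw, gw⟩ := exists_affine_eq_zero (H.contact C hC).isPreconnected
    (u • baryCoord K m - (1 - u) • baryCoord K n)
    (x := x) (y := y) ⟨hxC, mem_frontier_of_mem_segment h hs hm hx⟩
    ⟨hyC, mem_frontier_of_mem_segment h hs hn hy⟩
    (by rw [hg, x0]
        have := mul_nonneg hu0.le (h.mem_hull_iff.1 (mem_hull_of_mem_segment hs hm hx) m hm)
        linarith)
    (by rw [hg, y0]
        have := mul_nonneg (sub_nonneg.2 hu1.le)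
          (h.mem_hull_iff.1 (mem_hull_of_mem_segment hs hn hy) n hn)
        linarith)
  rw [hg] at gw
  obtain ⟨-, v, hv, hv0⟩ := h.mem_frontier_hull_iff.1 hw.2
  have h3 := sum w
  have hsw : baryCoord K m w = 0 → baryCoord K n w = 0 → False := fun h1 h2 => by
    have : w = s := ext (by rw [h1, h.baryCoord_ne hm hs hsm.symm])
      (by rw [h2, h.baryCoord_ne hn hs hsn.symm])
    exact hsC (this ▸ hw.1)
  by_cases e1 : v = m
  · subst e1
    rw [hv0, mul_zero, zero_sub, neg_eq_zero] at gw
    exact hsw hv0 ((mul_eq_zero.1 gw).resolve_left (by linarith))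
  by_cases e2 : v = n
  · subst e2
    rw [hv0, mul_zero, sub_zero] at gw
    exact hsw ((mul_eq_zero.1 gw).resolve_left hu0.ne') hv0
  have e3 := eq_of_ne_of_ne h hm hn hs hmn hsm hsn hv e1 e2
  subst e3
  have hnw : baryCoord K n w = u := by
    rw [hv0] at h3
    linear_combination u * h3 - gw
  have : w = z := ext (by rw [hmz]; linarith) hnw
  exact hzC (this ▸ hw.1)

/-! ### Lipschitz bounds for the boundary data -/

/-- The segment between x and y stays in C, so its resistance is at most |x - y| / a, while the
whole edge has resistance at least c₀ H_K / ρ. -/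
lemma abs_oscData_sub_le_of_mem_segment (hα : ∀ τ ∈ elements Tf, 0 < α τ) (hK : IsRefined Tf K)
    (hρ : 1 ≤ ρ) (hc₀ : 0 < c₀) (H : HighConductivityAssumption Tf α K ρ c₀ c₁) {p : Plane}
    (hp : p ∈ K) {C : Set Plane} (hC : C ∈ boundaryComponents Tf α K ρ) {a : ℝ} (ha : 0 < a)
    (hconst : ∀ τ ∈ fineElements Tf K, ρ < α τ → hull τ ⊆ C → α τ = a) {q r : Plane}
    (hq : q ∈ K) (hr : r ∈ K) (hqr : q ≠ r) {x y : Plane} (hx : x ∈ segment ℝ q r)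
    (hy : y ∈ segment ℝ q r) (hxC : x ∈ C) (hyC : y ∈ C) :
    |oscData Tf α K p x - oscData Tf α K p y| ≤
      ρ / (a * (c₀ * Metric.diam (hull K))) * dist x y := by
  have hdiam := hK.triangle.diam_pos
  have hρ0 : 0 < ρ := by linarith
  have hlow : ∀ q ∈ K, q ≠ p → ρ⁻¹ * (c₀ * Metric.diam (hull K)) ≤
      resistance Tf α K (segment ℝ q p) := fun q hq hqp => le_resistance_edge hα hK hρ H hq hp hqp
  have hR : ∀ q ∈ K, q ≠ p → 0 < resistance Tf α K (segment ℝ q p) := fun q hq hqp =>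
    lt_of_lt_of_le (by positivity) (hlow q hq hqp)
  have key : ∀ q ∈ K, q ≠ p → ∀ x ∈ segment ℝ q p, ∀ y ∈ segment ℝ q p, x ∈ C → y ∈ C →
      baryCoord K p x ≤ baryCoord K p y → |oscData Tf α K p x - oscData Tf α K p y| ≤
      ρ / (a * (c₀ * Metric.diam (hull K))) * dist x y := by
    intro q hq hqp x hx y hy hxC hyC hle
    rw [oscData_eq hK.triangle hR hp hq hqp hx, oscData_eq hK.triangle hR hp hq hqp hy, abs_sub_comm,
      ← sub_div, resistance_sub hK hqp hq hp hx hy hle,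
      abs_of_nonneg (div_nonneg (resistance_nonneg hα _) (hR q hq hqp).le)]
    have h1 := resistance_le_of_subset_component hK hq hp hC ha hconst
      ((convex_segment q p).segment_subset hx hy) (measurableSet_segment x y)
      (segment_subset_component hK.triangle hc₀ H hq hp hqp hC hx hy hxC hyC)
    rw [hausdorffMeasure_segment, edist_dist, ENNReal.toReal_ofReal dist_nonneg] at h1
    calc _ ≤ a⁻¹ * dist x y / (ρ⁻¹ * (c₀ * Metric.diam (hull K))) :=
          div_le_div₀ (by positivity) h1 (by positivity) (hlow q hq hqp)
      _ = _ := by field_simp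
  have key' : ∀ q ∈ K, q ≠ p → ∀ x ∈ segment ℝ q p, ∀ y ∈ segment ℝ q p, x ∈ C → y ∈ C →
      |oscData Tf α K p x - oscData Tf α K p y| ≤
      ρ / (a * (c₀ * Metric.diam (hull K))) * dist x y := by
    intro q hq hqp x hx y hy hxC hyC
    rcases le_total (baryCoord K p x) (baryCoord K p y) with hle | hle
    · exact key q hq hqp x hx y hy hxC hyC hle
    · rw [abs_sub_comm, dist_comm]
      exact key q hq hqp y hy x hx hyC hxC hle
  by_cases h1 : q = p
  · subst h1
    rw [segment_symm] at hx hy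
    exact key' r hr hqr.symm x hx y hy hxC hyC
  by_cases h2 : r = p
  · subst h2
    exact key' q hq hqr x hx y hy hxC hyC
  have z : ∀ w ∈ segment ℝ q r, oscData Tf α K p w = 0 := fun w hw =>
    oscData_eq_zero hK.triangle hp (mem_hull_of_mem_segment hq hr hw)
      (baryCoord_eq_zero_of_mem_segment hK.triangle hq hr hp (Ne.symm h1) (Ne.symm h2) hw)
  rw [z x hx, z y hy, sub_zero, abs_zero]
  positivity

/-- A lower bound for the angle at s: the coordinate of m vanishes along [s, n], so at x it is at
most σ |x - y| / diam, and it measures the distance of x from s. -/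
lemma dist_vertex_le (h : IsTriangle K) {σ : ℝ} (hσ : 0 < σ)
    (hreg : ∃ x, Metric.closedBall x (Metric.diam (hull K) / σ) ⊆ hull K) {s m n : Plane}
    (hs : s ∈ K) (hm : m ∈ K) (hn : n ∈ K) (hsm : s ≠ m) (hmn : m ≠ n) {x y : Plane}
    (hx : x ∈ segment ℝ s m) (hy : y ∈ segment ℝ s n) : dist x s ≤ σ * dist x y := by
  have hd := h.diam_pos
  have h1 := dist_edge h hsm hs hm hx (left_mem_segment ℝ s m)
  rw [h.baryCoord_ne hm hs hsm.symm, ← baryCoord_eq_zero_of_mem_segment h hs hn hm hsm.symm hmn hy]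
    at h1
  rw [h1]
  calc _ ≤ (σ / Metric.diam (hull K) * dist x y) * Metric.diam (hull K) := by
        refine mul_le_mul ((abs_affine_sub_le _ _ _).trans ?_) ?_ dist_nonneg (by positivity)
        · exact mul_le_mul_of_nonneg_right (h.norm_affGrad_baryCoord_le hσ hreg hm) dist_nonneg
        · exact Metric.dist_le_diam_of_mem (IsTriangle.isCompact_hull K).isBounded
            (subset_convexHull ℝ _ hs) (subset_convexHull ℝ _ hm)
    _ = _ := by field_simp

/-- On a contact set the boundary data are Lipschitz, with a constant inversely proportional to
the coefficient. -/
lemma abs_oscData_sub_le (hα : ∀ τ ∈ elements Tf, 0 < α τ) (hK : IsRefined Tf K)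
    (hρ : 1 ≤ ρ) (hc₀ : 0 < c₀) (H : HighConductivityAssumption Tf α K ρ c₀ c₁) {σ : ℝ}
    (hσ : 0 < σ) (hreg : ∃ x, Metric.closedBall x (Metric.diam (hull K) / σ) ⊆ hull K) {p : Plane}
    (hp : p ∈ K) {C : Set Plane} (hC : C ∈ boundaryComponents Tf α K ρ) {a : ℝ} (ha : 0 < a)
    (hconst : ∀ τ ∈ fineElements Tf K, ρ < α τ → hull τ ⊆ C → α τ = a) {x y : Plane}
    (hx : x ∈ C ∩ frontier (hull K)) (hy : y ∈ C ∩ frontier (hull K)) :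
    |oscData Tf α K p x - oscData Tf α K p y| ≤
      (1 + 2 * σ) * (ρ / (a * (c₀ * Metric.diam (hull K)))) * dist x y := by
  have h := hK.triangle
  have hdiam := h.diam_pos
  have hρ0 : 0 < ρ := by linarith
  set L := ρ / (a * (c₀ * Metric.diam (hull K))) with hL
  have hL0 : 0 ≤ L := by positivity
  have hd : 0 ≤ dist x y := dist_nonneg
  have seg {q r x y : Plane} (hq hr hqr hx hy hxC hyC) := abs_oscData_sub_le_of_mem_segment
    (q := q) (r := r) (x := x) (y := y) hα hK hρ hc₀ H hp hC ha hconst hq hr hqr hx hy hxC hyC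
  obtain ⟨v, hv, q, hq, r, hr, hqr, hqv, hrv, hxs⟩ := exists_mem_segment_of_mem_frontier h hx.2
  obtain ⟨hyK, v', hv', hv0'⟩ := h.mem_frontier_hull_iff.1 hy.2
  by_cases hvv : v' = v
  · have hys : y ∈ segment ℝ q r := mem_segment_of_baryCoord_eq_zero h hyK
      (fun w hw h1 h2 => eq_of_ne_of_ne h hq hr hv hqr hqv.symm hrv.symm hw h1 h2) (hvv ▸ hv0')
    refine (seg hq hr hqr hxs hys hx.1 hy.1).trans ?_
    have : 0 ≤ 2 * σ * (L * dist x y) := by positivity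
    rw [← hL]
    linarith
  -- For points on different edges, pass through the common vertex s, which belongs to C. The detour
  -- costs the factor 2σ; the 1 in 1 + 2σ serves the case of a common edge.
  · obtain ⟨s, hs, hsv, hsv'⟩ := exists_third_vertex h v v'
    have hx' : x ∈ segment ℝ s v' := mem_segment_of_baryCoord_eq_zero h
      (h.mem_frontier_hull_iff.1 hx.2).1
      (fun w hw h1 h2 => eq_of_ne_of_ne h hs hv' hv hsv' hsv.symm (Ne.symm hvv) hw h1 h2)
      (baryCoord_eq_zero_of_mem_segment h hq hr hv hqv.symm hrv.symm hxs)
    have hy' : y ∈ segment ℝ s v := mem_segment_of_baryCoord_eq_zero h hyK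
      (fun w hw h1 h2 => eq_of_ne_of_ne h hs hv hv' hsv hsv'.symm hvv hw h1 h2) hv0'
    have hsC := vertex_mem_component h hc₀ H hs hv' hv hsv' hsv hvv hC hx' hy' hx.1 hy.1
    have h1 := seg hs hv' hsv' hx' (left_mem_segment ℝ s v') hx.1 hsC
    have h2 := seg hs hv hsv (left_mem_segment ℝ s v) hy' hsC hy.1
    have h3 := dist_vertex_le h hσ hreg hs hv' hv hsv' hvv hx' hy'
    have h4 := dist_vertex_le h hσ hreg hs hv hv' hsv (Ne.symm hvv) hy' hx'
    rw [dist_comm y s, dist_comm y x] at h4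
    calc _ ≤ L * dist x s + L * dist s y := (abs_sub_le _ _ _).trans (add_le_add h1 h2)
      _ ≤ L * (σ * dist x y) + L * (σ * dist x y) := by gcongr
      _ ≤ _ := by
        have : 0 ≤ L * dist x y := by positivity
        linarith

end Contact

/-! ### The test function -/

section TestFunction

variable {Tf : Mesh} {α : Finset Plane → ℝ} {K : Finset Plane} {ρ c₀ c₁ σ : ℝ}

/-- A real Lipschitz function extends from the contact set to the plane with the same constant.
Truncation to [0, 1] preserves both the constant and the data, which already take values there. -/
lemma exists_lipschitz_extension (hα : ∀ τ ∈ elements Tf, 0 < α τ) (hK : IsRefined Tf K)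
    (hρ : 1 ≤ ρ) (hc₀ : 0 < c₀) (H : HighConductivityAssumption Tf α K ρ c₀ c₁)
    (hσ : 0 < σ) (hreg : ∃ x, Metric.closedBall x (Metric.diam (hull K) / σ) ⊆ hull K) {p : Plane}
    (hp : p ∈ K) {C : Set Plane} (hC : C ∈ boundaryComponents Tf α K ρ) :
    ∃ (a : ℝ) (g : Plane → ℝ), ρ < a ∧
      (∀ τ ∈ fineElements Tf K, ρ < α τ → hull τ ⊆ C → α τ = a) ∧
      (∀ x y, g x - g y ≤ (1 + 2 * σ) * (ρ / (a * (c₀ * Metric.diam (hull K)))) * dist x y) ∧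
      (∀ x ∈ C ∩ frontier (hull K), g x = oscData Tf α K p x) ∧ ∀ x, g x ∈ Icc (0 : ℝ) 1 := by
  obtain ⟨a, ha⟩ := H.constant C hC
  have hρ0 : 0 < ρ := by linarith
  have hdiam := hK.triangle.diam_pos
  have haρ : ρ < a := by
    obtain ⟨x, hx, -⟩ := (H.contact C hC).nonempty
    obtain ⟨τ, hτ, hτρ, hxτ⟩ := exists_of_mem_highRegion (component_subset hC hx)
    rwa [← ha τ hτ hτρ (hull_subset_component hC hτ hτρ hx hxτ)]
  have ha0 : 0 < a := hρ0.trans haρ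
  have hR : ∀ q ∈ K, q ≠ p → 0 < resistance Tf α K (segment ℝ q p) := fun q hq hqp =>
    lt_of_lt_of_le (by positivity) (le_resistance_edge hα hK hρ H hq hp hqp)
  set L := (1 + 2 * σ) * (ρ / (a * (c₀ * Metric.diam (hull K)))) with hL
  have hL0 : 0 ≤ L := by positivity
  have hlip : LipschitzOnWith L.toNNReal (oscData Tf α K p) (C ∩ frontier (hull K)) :=
    LipschitzOnWith.of_dist_le_mul fun x hx y hy => by
      rw [Real.coe_toNNReal _ hL0, Real.dist_eq]
      exact abs_oscData_sub_le hα hK hρ hc₀ H hσ hreg hp hC ha0 ha hx hy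
  obtain ⟨g, hg, hgeq⟩ := hlip.extend_real
  refine ⟨a, fun x => max 0 (min 1 (g x)), haρ, ha, fun x y => ?_, fun x hx => ?_, fun x => ?_⟩
  · have h1 := hg.dist_le_mul x y
    rw [Real.coe_toNNReal _ hL0, Real.dist_eq] at h1
    calc max 0 (min 1 (g x)) - max 0 (min 1 (g y))
        ≤ |max (min 1 (g x)) 0 - max (min 1 (g y)) 0| := by
          rw [max_comm, max_comm 0]; exact le_abs_self _
      _ ≤ |min (g x) 1 - min (g y) 1| := by
          rw [min_comm 1, min_comm 1]; exact abs_max_sub_max_le_abs _ _ _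
      _ ≤ |g x - g y| := by
          simpa using abs_min_sub_min_le_max (g x) 1 (g y) 1
      _ ≤ _ := h1
  · have h1 := oscData_mem_Icc hα hK hR hp x
    change max 0 (min 1 (g x)) = _
    rw [← hgeq hx, min_eq_right h1.2, max_eq_right h1.1]
  · exact ⟨le_max_left _ _, max_le zero_le_one (min_le_left _ _)⟩

open Classical in
/-- The nodal values of the test function: the boundary data on `∂K`, an extension `g C` of them
on each component `C` of `K^B(ρ)`, and zero elsewhere. -/
def testNodal (Tf : Mesh) (α : Finset Plane → ℝ) (K : Finset Plane) (ρ : ℝ) (p : Plane)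
    (g : Set Plane → Plane → ℝ) (x : Plane) : ℝ :=
  if x ∈ frontier (hull K) then oscData Tf α K p x
  else if h : ∃ C ∈ boundaryComponents Tf α K ρ, x ∈ C then g h.choose x else 0

/-- On C a single Lipschitz function governs all nodes, those on ∂K included, because the extension
matches the data there and components are disjoint. -/
lemma testNodal_of_mem {p : Plane} {g : Set Plane → Plane → ℝ} {C : Set Plane}
    (hC : C ∈ boundaryComponents Tf α K ρ)
    (hg : ∀ x ∈ C ∩ frontier (hull K), g C x = oscData Tf α K p x) {x : Plane} (hx : x ∈ C) :
    testNodal Tf α K ρ p g x = g C x := by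
  rw [testNodal]
  split_ifs with h1 h2
  · exact (hg x ⟨hx, h1⟩).symm
  · rw [component_unique h2.choose_spec.1 hC h2.choose_spec.2 hx]
  · exact (h2 ⟨C, hC, hx⟩).elim

lemma testNodal_eq_zero {p : Plane} {g : Set Plane → Plane → ℝ} {x : Plane}
    (h1 : x ∉ frontier (hull K)) (h2 : x ∉ boundaryPart Tf α K ρ) :
    testNodal Tf α K ρ p g x = 0 := by
  rw [testNodal, if_neg h1, dif_neg]
  rintro ⟨C, hC, hx⟩
  exact h2 ⟨C, hC, hx⟩

lemma testNodal_mem_Icc {p : Plane} {g : Set Plane → Plane → ℝ}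
    (hosc : ∀ x, oscData Tf α K p x ∈ Icc (0 : ℝ) 1)
    (hg : ∀ C ∈ boundaryComponents Tf α K ρ, ∀ x, g C x ∈ Icc (0 : ℝ) 1) (x : Plane) :
    testNodal Tf α K ρ p g x ∈ Icc (0 : ℝ) 1 := by
  rw [testNodal]
  split_ifs with h1 h2
  · exact hosc x
  · exact hg _ h2.choose_spec.1 x
  · simp

lemma boundaryPart_subset : boundaryPart Tf α K ρ ⊆ highRegion Tf α K ρ :=
  sUnion_subset fun _ hC => component_subset hC

lemma disjoint_interior_boundaryPart {τ : Finset Plane} (hτ : τ ∈ fineElements Tf K)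
    (hρ : α τ ≤ ρ) : Disjoint (interior (hull τ)) (boundaryPart Tf α K ρ) := by
  rw [Set.disjoint_left]
  intro x hx hxB
  obtain ⟨τ', hτ', hρ', hx'⟩ := exists_of_mem_highRegion (boundaryPart_subset hxB)
  refine Set.disjoint_left.1 (disjoint_interior_hull hτ.1 hτ'.1 ?_) hx hx'
  rintro rfl
  linarith

lemma meshSize_le_mul_diam (hK : IsRefined Tf K) (hT : QuasiUniform Tf σ) (hσ : 0 < σ) :
    meshSize Tf ≤ σ * Metric.diam (hull K) := by
  obtain ⟨v, hv⟩ := hK.triangle.nonempty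
  obtain ⟨τ, hτ, -⟩ := hK.exists_mem (subset_convexHull ℝ _ hv)
  exact (hT.2 τ hτ.1).trans (mul_le_mul_of_nonneg_left
    (Metric.diam_mono hτ.2 (IsTriangle.isCompact_hull K).isBounded) hσ.le)

lemma meshSize_pos (hK : IsRefined Tf K) (hfin : (elements Tf).Finite) : 0 < meshSize Tf := by
  obtain ⟨v, hv⟩ := hK.triangle.nonempty
  obtain ⟨τ, hτ, -⟩ := hK.exists_mem (subset_convexHull ℝ _ hv)
  exact (isTriangle_of_mem_elements hτ.1).diam_pos.trans_le (diam_le_meshSize hfin hτ.1)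

lemma hausdorffMeasure_frontier_le (h : IsTriangle K) :
    μH[1] (frontier (hull K)) ≤ ENNReal.ofReal (9 * Metric.diam (hull K)) := by
  -- The constant 9 counts all ordered pairs of vertices, a crude cover of the three edges.
  have hsub : frontier (hull K) ⊆ ⋃ e ∈ K ×ˢ K, segment ℝ e.1 e.2 := fun x hx => by
    obtain ⟨v, hv, q, hq, r, hr, -, -, -, hxs⟩ := exists_mem_segment_of_mem_frontier h hx
    exact mem_biUnion (x := (q, r)) (Finset.mem_product.2 ⟨hq, hr⟩) hxs
  refine (measure_mono hsub).trans ((measure_biUnion_finset_le _ _).trans ?_)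
  have : ∀ e ∈ K ×ˢ K, μH[1] (segment ℝ e.1 e.2) ≤ ENNReal.ofReal (Metric.diam (hull K)) := by
    intro e he
    rw [hausdorffMeasure_segment, edist_dist]
    exact ENNReal.ofReal_le_ofReal (Metric.dist_le_diam_of_mem
      (IsTriangle.isCompact_hull K).isBounded (subset_convexHull ℝ _ (Finset.mem_product.1 he).1)
      (subset_convexHull ℝ _ (Finset.mem_product.1 he).2))
  refine (Finset.sum_le_card_nsmul _ _ _ this).trans ?_
  rw [Finset.card_product, h.card, ENNReal.ofReal_mul (by norm_num), nsmul_eq_mul]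
  norm_num

open Classical in
/-- There are at most `O(H / h)` fine elements with a vertex on the boundary of `K`. -/
lemma card_boundary_elements_mul_le (hK : IsRefined Tf K) (hT : QuasiUniform Tf σ) (hσ : 0 < σ)
    (hfin : (elements Tf).Finite)
    (hreg : ∃ x, Metric.closedBall x (Metric.diam (hull K) / σ) ⊆ hull K) :
    ((hK.finite.toFinset.filter fun τ => ∃ v ∈ τ, v ∈ frontier (hull K)).card : ℝ) * meshSize Tf ≤
      countConst σ * (9 * Metric.diam (hull K)) := by
  refine card_mul_meshSize_le hσ hT hfin (meshSize_pos hK hfin) (fun τ hτ => ?_) ?_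
    (hausdorffMeasure_frontier_le hK.triangle) fun τ hτ => ?_
  · have := (Finset.mem_filter.1 hτ).1
    exact ((hK.finite.mem_toFinset).1 this).1
  · have := hK.triangle.diam_pos
    positivity
  · obtain ⟨-, v, hv, hvK⟩ := Finset.mem_filter.1 hτ
    refine ⟨v, subset_convexHull ℝ _ hv, fun s hs => ?_⟩
    obtain ⟨-, -, q, hq, r, hr, hqr, -, -, hvs⟩ :=
      exists_mem_segment_of_mem_frontier hK.triangle hvK
    obtain ⟨x, hx, hxs⟩ := exists_mem_segment_dist_eq hvs hs.1.le (by
      have h1 := diam_le_mul_dist hK.triangle hσ hreg hq hr hqr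
      have h2 := meshSize_le_mul_diam hK hT hσ
      have h3 := hs.2
      rw [lt_div_iff₀ (by positivity)] at h3
      refine le_of_mul_le_mul_right (a := σ ^ 2) ?_ (by positivity)
      nlinarith)
    exact ⟨x, mem_frontier_of_mem_segment hK.triangle hq hr hx, hxs⟩

open Classical in
/-- There are at most `O(H / h)` fine elements outside `K^B(ρ)` with a vertex in `K^B(ρ)`. -/
lemma card_interface_elements_mul_le (hK : IsRefined Tf K) (hT : QuasiUniform Tf σ) (hσ : 0 < σ)
    (hfin : (elements Tf).Finite) (H : HighConductivityAssumption Tf α K ρ c₀ c₁) :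
    ((hK.finite.toFinset.filter fun τ =>
      α τ ≤ ρ ∧ ∃ v ∈ τ, v ∈ boundaryPart Tf α K ρ).card : ℝ) * meshSize Tf ≤
      countConst σ * (max c₁ 0 * Metric.diam (hull K)) := by
  have hd := hK.triangle.diam_pos
  -- The constant c₁ carries no sign, hence the truncation at 0.
  refine card_mul_meshSize_le hσ hT hfin (meshSize_pos hK hfin) (fun τ hτ => ?_) (by positivity)
    (H.perimeter.trans (ENNReal.ofReal_le_ofReal
      (mul_le_mul_of_nonneg_right (le_max_left _ _) hd.le))) fun τ hτ => ?_
  · exact ((hK.finite.mem_toFinset).1 (Finset.mem_filter.1 hτ).1).1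
  · obtain ⟨hτK, hρ, v, hv, C, hC, hvC⟩ := Finset.mem_filter.1 hτ
    rw [hK.finite.mem_toFinset] at hτK
    refine ⟨v, subset_convexHull ℝ _ hv, fun s hs => ?_⟩
    obtain ⟨τ', hτ', hρ', hv'⟩ := exists_of_mem_highRegion (component_subset hC hvC)
    exact exists_mem_frontier_dist_eq hσ hT hτ'.1 hτK.1
      ((hull_subset_component hC hτ' hρ' hvC hv').trans (subset_sUnion_of_mem hC))
      (disjoint_interior_boundaryPart hτK hρ) hv' (subset_convexHull ℝ _ hv) hs

/-- The constant of the main estimate. -/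
def energyConst (σ c₀ c₁ : ℝ) : ℝ :=
  -- First the boundary components, with an extra σ from 1 ≤ σ H_K / h; then the low elements near
  -- ∂K (the 9) and near K^B(ρ) (the perimeter constant).
  σ * (σ ^ 2 * (1 + 2 * σ) ^ 2 / c₀ ^ 2 * Real.pi) +
    Real.pi * σ ^ 2 * (countConst σ * (9 + max c₁ 0))

lemma energyConst_pos (hσ : 0 < σ) (hc₀ : 0 < c₀) : 0 < energyConst σ c₀ c₁ := by
  have h1 : 0 ≤ countConst σ := by unfold countConst; positivity
  have := Real.pi_pos
  unfold energyConst
  positivity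

/-! ### Energy of the test function, element by element -/

/-- Elements with P are charged by area, the others by number. An element in both S₁ and S₂ may be
charged twice. -/
lemma sum_elementEnergy_le {f : Finset Plane → ℝ} {A ρ : ℝ} {S S₁ S₂ : Finset (Finset Plane)}
    {P : Finset Plane → Prop} (hP : ∀ τ ∈ S, P τ → f τ ≤ A * area τ) (hA : 0 ≤ A) (hρ : 0 ≤ ρ)
    (h1 : ∀ τ ∈ S, ¬ P τ → f τ ≤ ρ) (hS₁ : S₁ ⊆ S) (hS₂ : S₂ ⊆ S)
    (h0 : ∀ τ ∈ S, ¬ P τ → τ ∉ S₁ → τ ∉ S₂ → f τ ≤ 0) :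
    ∑ τ ∈ S, f τ ≤ A * ∑ τ ∈ S, area τ + ρ * (S₁.card + S₂.card) := by
  classical
  have hc : ∀ T ⊆ S, ∑ τ ∈ S, (if τ ∈ T then ρ else 0) = ρ * T.card := fun T hT => by
    rw [← Finset.sum_filter, Finset.filter_mem_eq_inter, Finset.inter_eq_right.2 hT,
      Finset.sum_const, nsmul_eq_mul, mul_comm]
  rw [mul_add, ← hc S₁ hS₁, ← hc S₂ hS₂, Finset.mul_sum, ← Finset.sum_add_distrib,
    ← Finset.sum_add_distrib]
  refine Finset.sum_le_sum fun τ hτ => ?_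
  have hAτ := mul_nonneg hA (area_nonneg τ)
  by_cases hPτ : P τ
  · have := hP τ hτ hPτ
    split_ifs <;> linarith
  · have h2 := h1 τ hτ hPτ
    have h3 := h0 τ hτ hPτ
    split_ifs with a b b
    · linarith
    · linarith
    · linarith
    · linarith [h3 a b]

lemma elementEnergy_le {τ : Finset Plane} (h : IsTriangle τ) (hσ : 0 < σ)
    (hreg : ∃ x, Metric.closedBall x (Metric.diam (hull τ) / σ) ⊆ hull τ) {f : Plane → ℝ} {M : ℝ}
    (hM : ∀ v ∈ τ, ∀ w ∈ τ, f v - f w ≤ M) {a : ℝ} (ha : 0 ≤ a) :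
    a * area τ * inner ℝ (affGrad (interp τ f)) (affGrad (interp τ f)) ≤
      a * area τ * (σ * M / Metric.diam (hull τ)) ^ 2 := by
  rw [real_inner_self_eq_norm_sq]
  refine mul_le_mul_of_nonneg_left ?_ (mul_nonneg ha (area_nonneg τ))
  refine pow_le_pow_left₀ (norm_nonneg _) (h.norm_affGrad_le hσ hreg fun v hv w hw => ?_) 2
  rw [h.interp_vertex f hv, h.interp_vertex f hw]
  exact hM v hv w hw

/-- There is a function in `S^h(K)` with the oscillatory boundary data and energy of order
`ρ * H / h`. -/
lemma exists_test_function (hα : ∀ τ ∈ elements Tf, 0 < α τ) (hK : IsRefined Tf K)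
    (hfin : (elements Tf).Finite) (hT : QuasiUniform Tf σ) (hρ : 1 ≤ ρ) (hc₀ : 0 < c₀)
    (H : HighConductivityAssumption Tf α K ρ c₀ c₁) (hσ : 0 < σ)
    (hreg : ∃ x, Metric.closedBall x (Metric.diam (hull K) / σ) ⊆ hull K) {p : Plane}
    (hp : p ∈ K) : ∃ u, IsP1 Tf K u ∧ HasOscillatoryData Tf α K p u ∧
      energyForm Tf α K u u ≤
        energyConst σ c₀ c₁ * (ρ * (Metric.diam (hull K) / meshSize Tf)) := by
  classical
  have hρ0 : 0 < ρ := by linarith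
  have hd := hK.triangle.diam_pos
  have hh := meshSize_pos hK hfin
  have hR : ∀ q ∈ K, q ≠ p → 0 < resistance Tf α K (segment ℝ q p) := fun q hq hqp =>
    lt_of_lt_of_le (by positivity) (le_resistance_edge hα hK hρ H hq hp hqp)
  have hosc := oscData_mem_Icc hα hK hR hp
  have hext := fun C (hC : C ∈ boundaryComponents Tf α K ρ) =>
    exists_lipschitz_extension hα hK hρ hc₀ H hσ hreg hp hC
  choose! a g haρ ha hlip hgosc hgI using hext
  set f := testNodal Tf α K ρ p g with hf
  have hfI : ∀ x, f x ∈ Icc (0 : ℝ) 1 := testNodal_mem_Icc hosc hgI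
  refine ⟨nodalInterp Tf K f, isP1_nodalInterp hK f,
    hasOscillatoryData_nodalInterp hK hR hp fun τ _ v _ hv => by rw [hf, testNodal, if_pos hv], ?_⟩
  rw [(isP1_nodalInterp hK f).energyForm_eq hK (isP1_nodalInterp hK f)]
  have hint : ∀ τ ∈ hK.finite.toFinset, interp τ (nodalInterp Tf K f) = interp τ f := by
    intro τ hτ
    rw [hK.finite.mem_toFinset] at hτ
    exact (isTriangle_of_mem_elements hτ.1).interp_eq fun v hv =>
      nodalInterp_eqOn f hτ (subset_convexHull ℝ _ hv)
  rw [Finset.sum_congr rfl fun τ hτ => by rw [hint τ hτ]]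
  -- A bounds the energy density a (σ L)² on a component, after the factor ρ / a ≤ 1 is dropped.
  set A := σ ^ 2 * (1 + 2 * σ) ^ 2 / c₀ ^ 2 * (ρ / Metric.diam (hull K) ^ 2) with hA
  have hzero : ∀ τ, (∀ v ∈ τ, f v = 0) → IsTriangle τ →
      α τ * area τ * inner ℝ (affGrad (interp τ f)) (affGrad (interp τ f)) = 0 := by
    intro τ hv hτ
    rw [hτ.interp_eq (g := 0) fun v hvτ => by rw [hv v hvτ]; rfl]
    simp
  have hsum := sum_elementEnergy_le
    (f := fun τ => α τ * area τ * inner ℝ (affGrad (interp τ f)) (affGrad (interp τ f)))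
    (A := A) (ρ := ρ * (Real.pi * σ ^ 2)) (S := hK.finite.toFinset)
    (S₁ := hK.finite.toFinset.filter fun τ => ∃ v ∈ τ, v ∈ frontier (hull K))
    (S₂ := hK.finite.toFinset.filter fun τ => α τ ≤ ρ ∧ ∃ v ∈ τ, v ∈ boundaryPart Tf α K ρ)
    (P := fun τ => ρ < α τ) (fun τ hτ hτρ => ?_) (by positivity) (by positivity)
    (fun τ hτ hτρ => ?_) (Finset.filter_subset _ _) (Finset.filter_subset _ _)
    (fun τ hτ hτρ h1 h2 => ?_)
  · refine hsum.trans ?_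
    have h1 := card_boundary_elements_mul_le hK hT hσ hfin hreg
    have h2 := card_interface_elements_mul_le hK hT hσ hfin H
    have h3 := mul_le_mul_of_nonneg_left hK.sum_area_le (show 0 ≤ A by positivity)
    -- The components contribute O(ρ) without H/h; h ≤ σ H_K absorbs this into the final form.
    have h4 := meshSize_le_mul_diam hK hT hσ
    refine (add_le_add_left h3 _).trans ?_
    rw [← mul_div_assoc, ← mul_div_assoc, le_div_iff₀ hh, add_mul,
      mul_assoc (ρ * (Real.pi * σ ^ 2)) _ (meshSize Tf),
      add_mul _ _ (meshSize Tf)]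
    have h5 : A * (Metric.diam (hull K) ^ 2 * Real.pi) =
        σ ^ 2 * (1 + 2 * σ) ^ 2 / c₀ ^ 2 * Real.pi * ρ := by
      rw [hA]; field_simp
    rw [h5]
    calc _ ≤ σ ^ 2 * (1 + 2 * σ) ^ 2 / c₀ ^ 2 * Real.pi * ρ * (σ * Metric.diam (hull K)) +
          ρ * (Real.pi * σ ^ 2) * (countConst σ * (9 * Metric.diam (hull K)) +
            countConst σ * (max c₁ 0 * Metric.diam (hull K))) := by
          have := Real.pi_pos
          gcongr
      _ = _ := by rw [energyConst]; ring
  · rw [hK.finite.mem_toFinset] at hτ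
    have htri := isTriangle_of_mem_elements hτ.1
    have hdτ := htri.diam_pos
    by_cases hex : ∃ C ∈ boundaryComponents Tf α K ρ, hull τ ⊆ C
    · obtain ⟨C, hC, hτC⟩ := hex
      have ha0 : 0 < a C := hρ0.trans (haρ C hC)
      set L := (1 + 2 * σ) * (ρ / (a C * (c₀ * Metric.diam (hull K)))) with hL
      have hv := fun v (hv : v ∈ τ) => hτC (subset_convexHull ℝ _ hv)
      have h1 := elementEnergy_le htri hσ (hT.1 τ hτ.1) (f := f)
        (M := L * Metric.diam (hull τ)) (fun v hvτ w hwτ => by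
          rw [hf, testNodal_of_mem hC (hgosc C hC) (hv v hvτ),
            testNodal_of_mem hC (hgosc C hC) (hv w hwτ)]
          refine (hlip C hC v w).trans (mul_le_mul_of_nonneg_left ?_ (by positivity))
          exact Metric.dist_le_diam_of_mem (IsTriangle.isCompact_hull τ).isBounded
            (subset_convexHull ℝ _ hvτ) (subset_convexHull ℝ _ hwτ)) (hα τ hτ.1).le
      refine h1.trans ?_
      rw [ha C hC τ hτ hτρ hτC, ← mul_assoc, mul_div_cancel_right₀ _ hdτ.ne']
      have h2 : a C * area τ * (σ * L) ^ 2 = A * area τ * (ρ / a C) := by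
        rw [hA, hL]; field_simp
      rw [h2]
      exact mul_le_of_le_one_right (mul_nonneg (by positivity) (area_nonneg τ))
        ((div_le_one ha0).2 (haρ C hC).le)
    -- A high element outside all boundary components has no vertex on ∂K or in K^B(ρ), since such a
    -- vertex would put it into one. All its nodal values are 0, so the size of α there is
    -- irrelevant.
    · refine (hzero τ (fun v hv => ?_) htri).le.trans (mul_nonneg (by positivity) (area_nonneg τ))
      have hvτ := subset_convexHull ℝ (τ : Set Plane) hv
      refine testNodal_eq_zero (fun hvK => ?_) ?_
      · obtain ⟨C, hC, hvC⟩ :=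
          exists_component_of_mem_frontier (hull_subset_highRegion hτ hτρ hvτ) hvK
        exact hex ⟨C, hC, hull_subset_component hC hτ hτρ hvC hvτ⟩
      · rintro ⟨C, hC, hvC⟩
        exact hex ⟨C, hC, hull_subset_component hC hτ hτρ hvC hvτ⟩
  · rw [hK.finite.mem_toFinset] at hτ
    have htri := isTriangle_of_mem_elements hτ.1
    have hdτ := htri.diam_pos
    -- On a low element the oscillation is at most 1, and the area π diam² cancels the squared slope
    -- (σ / diam)².
    have h1 := elementEnergy_le htri hσ (hT.1 τ hτ.1) (f := f) (M := 1)
      (fun v _ w _ => by linarith [(hfI v).2, (hfI w).1]) (hα τ hτ.1).le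
    refine h1.trans ?_
    calc α τ * area τ * (σ * 1 / Metric.diam (hull τ)) ^ 2
        ≤ ρ * (Metric.diam (hull τ) ^ 2 * Real.pi) * (σ * 1 / Metric.diam (hull τ)) ^ 2 := by
          gcongr
          · exact area_nonneg τ
          · exact not_lt.1 hτρ
          · exact htri.area_le
      _ = _ := by field_simp
  · have hτ' := hτ
    rw [hK.finite.mem_toFinset] at hτ'
    refine (hzero τ (fun v hv => testNodal_eq_zero (fun hvK => ?_) fun hvB => ?_)
      (isTriangle_of_mem_elements hτ'.1)).le
    · exact h1 (Finset.mem_filter.2 ⟨hτ, v, hv, hvK⟩)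
    · exact h2 (Finset.mem_filter.2 ⟨hτ, not_lt.1 hτρ, v, hv, hvB⟩)

end TestFunction

/-- The set of energies of the basis functions is finite. -/
lemma finite_basisEnergies {Tf Tc : Mesh} {α : Finset Plane → ℝ}
    (hα : ∀ τ ∈ elements Tf, 0 < α τ) (hfin : (elements Tc).Finite)
    (hK : ∀ K ∈ elements Tc, IsRefined Tf K) : (basisEnergies Tf Tc α).Finite := by
  have : basisEnergies Tf Tc α ⊆ ⋃ K ∈ elements Tc, ⋃ p ∈ K,
      {E | ∃ φ, IsMultiscaleBasis Tf α K p φ ∧ E = energyForm Tf α K φ φ} := by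
    rintro E ⟨K, hKe, p, hp, h⟩
    exact mem_biUnion hKe (mem_biUnion (x := p) hp h)
  refine (hfin.biUnion fun K hKe => K.finite_toSet.biUnion fun p hp => ?_).subset this
  -- Two basis functions for the same K and p compete with each other, so their energies coincide.
  refine Set.Subsingleton.finite ?_
  rintro _ ⟨φ, hφ, rfl⟩ _ ⟨φ', hφ', rfl⟩
  exact le_antisymm (hφ.energy_le hα (hK K hKe) hp hφ'.isP1 hφ'.boundary)
    (hφ'.energy_le hα (hK K hKe) hp hφ.isP1 hφ.boundary)

end MSFEM

end

/-! ### Existence, attainment and the bound for the indicator -/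

theorem mainTheorem3 (σ c₀ c₁ : ℝ) (hσ : 0 < σ) (hc₀ : 0 < c₀) :
    ∃ C : ℝ, 0 < C ∧
      ∀ (Ω : Set MSFEM.Plane) (Tf Tc : MSFEM.Mesh) (α : Finset MSFEM.Plane → ℝ) (ρ : ℝ),
        IsOpen Ω → IsConnected Ω →
        MSFEM.IsTriangulation Tf (closure Ω) → MSFEM.IsTriangulation Tc (closure Ω) →
        MSFEM.QuasiUniform Tf σ → MSFEM.QuasiUniform Tc σ → MSFEM.Aligned Tf Tc →
        (∀ τ ∈ MSFEM.elements Tf, 0 < α τ) →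
        1 ≤ ρ →
        (∀ K ∈ MSFEM.elements Tc, MSFEM.HighConductivityAssumption Tf α K ρ c₀ c₁) →
        (∀ K ∈ MSFEM.elements Tc, ∀ p ∈ K, ∃ φ, MSFEM.IsMultiscaleBasis Tf α K p φ) ∧
        IsGreatest (MSFEM.basisEnergies Tf Tc α) (MSFEM.coarseIndicator Tf Tc α) ∧
        MSFEM.coarseIndicator Tf Tc α ≤
          C * (ρ * (MSFEM.meshSize Tc / MSFEM.meshSize Tf)) := by
  refine ⟨MSFEM.energyConst σ c₀ c₁, MSFEM.energyConst_pos hσ hc₀, ?_⟩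
  intro Ω Tf Tc α ρ _ hΩ hTf hTc hqf hqc hal hα hρ H
  have hfin := MSFEM.finite_elements hTf
  have hfinc := MSFEM.finite_elements hTc
  have hK := fun K (hK : K ∈ MSFEM.elements Tc) => MSFEM.isRefined hTf hTc hal hK
  have htest := fun K (hKe : K ∈ MSFEM.elements Tc) p (hp : p ∈ K) =>
    MSFEM.exists_test_function hα (hK K hKe) hfin hqf hρ hc₀ (H K hKe) hσ (hqc.1 K hKe) hp
  have hex : ∀ K ∈ MSFEM.elements Tc, ∀ p ∈ K, ∃ φ, MSFEM.IsMultiscaleBasis Tf α K p φ :=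
    fun K hKe p hp => by
      obtain ⟨u, hu, hb, -⟩ := htest K hKe p hp
      exact MSFEM.exists_isMultiscaleBasis hα (hK K hKe) hp hu hb
  have hfinE := MSFEM.finite_basisEnergies hα hfinc hK
  have hne : (MSFEM.basisEnergies Tf Tc α).Nonempty := by
    obtain ⟨x, hx⟩ := hΩ.nonempty
    obtain ⟨K, hKe, -⟩ := MSFEM.exists_element_of_mem hTc (subset_closure hx)
    obtain ⟨p, hp⟩ := (hK K hKe).triangle.nonempty
    obtain ⟨φ, hφ⟩ := hex K hKe p hp
    exact ⟨_, K, hKe, p, hp, φ, hφ, rfl⟩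
  -- The set of energies is finite and nonempty, so `sSup` is a true maximum and not a default
  -- value.
  refine ⟨hex, ⟨hne.csSup_mem hfinE, fun E hE => le_csSup hfinE.bddAbove hE⟩, ?_⟩
  refine csSup_le hne ?_
  rintro _ ⟨K, hKe, p, hp, φ, hφ, rfl⟩
  obtain ⟨u, hu, hb, hE⟩ := htest K hKe p hp
  refine (hφ.energy_le hα (hK K hKe) hp hu hb).trans (hE.trans ?_)
  have h1 := MSFEM.diam_le_meshSize hfinc hKe
  have h2 := MSFEM.meshSize_pos (hK K hKe) hfin
  have h3 := MSFEM.energyConst_pos (c₁ := c₁) hσ hc₀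
  gcongr
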